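/- **Setting.** A circular dielectric cylinder of radius $\rho_{\rm cyl}>0$ (region 2, parameters $\varepsilon_2,\mu_2>0$) lies in a homogeneous medium (region 1, parameters $\varepsilon_1,\mu_1>0$); $\omega>0$, $k_j=\omega\sqrt{\varepsilon_j\mu_j}$, $Z_j=\sqrt{\mu_j/\varepsilon_j}$. Let $J_n$ be the Bessel functions, $H_n=H_n^{(2)}=J_n-\mathrm iY_n$ the Hankel functions of the second kind, $J_n'$, $H_n'$ their derivatives with respect to the argument, and $D(a,b,\theta)=\sqrt{a^2+b^2-2ab\cos\theta}$. An electric filament of current $I\in\mathbb C$ at polar coordinates $(\rho_{\rm fil},0)$ in region $j$ produces $$E_j^{\rm inc}(\rho,\phi)=-\tfrac{k_jZ_j}{4}\,I\,H_0(k_jD(\rho,\rho_{\rm fil},\phi)).$$ Densities $J^s,M^s$ on the circle $\rho=\rho_{\rm cyl}$ radiate in an unbounded medium $j$, at $\rho\neq\rho_{\rm cyl}$, the field $$\mathcal E_j[J^s,M^s](\rho,\phi)=-\tfrac{k_jZ_j\rho_{\rm cyl}}{4}\int_{-\pi}^{\pi}J^s(\phi')H_0(k_jD)\,d\phi'+\tfrac{k_j\rho_{\rm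 cyl}}{4\mathrm i}\int_{-\pi}^{\pi}M^s(\phi')\tfrac{\rho_{\rm cyl}-\rho\cos(\phi'-\phi)}{D}H_1(k_jD)\,d\phi',$$ with $D=D(\rho_{\rm cyl},\rho,\phi'-\phi)$. For auxiliary radii $0<\rho^{(1)}_{\rm aux}<\rho_{\rm cyl}<\rho^{(2)}_{\rm aux}$ the system of extended integral equations for $J^s,M^s\in L^1(-\pi,\pi)$ requires, for all real $\phi$: * external excitation ($\rho_{\rm fil}>\rho_{\rm cyl}$): $E_1^{\rm inc}+\mathcal E_1[J^s,M^s]=0$ at $(\rho^{(1)}_{\rm aux},\phi)$ and $\mathcal E_2[-J^s,-M^s]=0$ at $(\rho^{(2)}_{\rm aux},\phi)$; * internal excitation ($0\le\rho_{\rm fil}<\rho_{\rm cyl}$): $\mathcal E_1[J^s,M^s]=0$ at $(\rho^{(1)}_{\rm aux},\phi)$ and $E_2^{\rm inc}+\mathcal E_2[-J^s,-M^s]=0$ at $(\rho^{(2)}_{\rm aux},\phi)$. **Theorem.** For every $n\in\mathbb Z$, $$\Delta_n=Z_1H_n(k_1\rho_{\rm cyl})J_n'(k_2\rho_{\rm cyl})-Z_2H_n'(k_1\rho_{\rm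 cyl})J_n(k_2\rho_{\rm cyl})\neq0.$$ For all auxiliary radii as above, the system is solvable, and a solution is given by the following series, in which the auxiliary radii do not occur. External excitation: $$J^s(\phi)=-\frac{I}{2\pi\rho_{\rm cyl}}\sum_{n\in\mathbb Z}a_ne^{\mathrm in\phi},\quad M^s(\phi)=\frac{I}{2\pi\rho_{\rm cyl}}\sum_{n\in\mathbb Z}b_ne^{\mathrm in\phi},$$ $$a_n=\frac{Z_1H_n(k_1\rho_{\rm fil})J_n'(k_2\rho_{\rm cyl})}{\Delta_n},\qquad b_n=\frac{\mathrm iZ_1Z_2H_n(k_1\rho_{\rm fil})J_n(k_2\rho_{\rm cyl})}{\Delta_n}.$$ Internal excitation: $$J^s(\phi)=\frac{I}{2\pi\rho_{\rm cyl}}\sum_{n\in\mathbb Z}\tilde a_ne^{\mathrm in\phi},\quad M^s(\phi)=-\frac{I}{2\pi\rho_{\rm cyl}}\sum_{n\in\mathbb Z}\tilde b_ne^{\mathrm in\phi},$$ $$\tilde a_n=\frac{Z_2J_n(k_2\rho_{\rm fil})H_n'(k_1\rho_{\rm cyl})}{-\Delta_n},\qquad \tilde b_n=\frac{\mathrm iZ_1Z_2J_n(k_2\rho_{\rm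 fil})H_n(k_1\rho_{\rm cyl})}{-\Delta_n}.$$ All four series converge absolutely (uniformly in $\phi$), and their coefficients decay geometrically: as $|n|\to\infty$, $$a_n\sim\frac{Z_1}{Z_1+Z_2k_2/k_1}\Big(\frac{\rho_{\rm cyl}}{\rho_{\rm fil}}\Big)^{|n|},\qquad b_n\sim\frac{\mathrm iZ_1Z_2}{Z_1/k_2+Z_2/k_1}\,\frac{\rho_{\rm cyl}}{|n|}\Big(\frac{\rho_{\rm cyl}}{\rho_{\rm fil}}\Big)^{|n|},$$ $$\tilde a_n\sim\frac{Z_2}{Z_2+Z_1k_1/k_2}\Big(\frac{\rho_{\rm fil}}{\rho_{\rm cyl}}\Big)^{|n|},\qquad \tilde b_n\sim\frac{-\mathrm iZ_1Z_2}{Z_1/k_2+Z_2/k_1}\,\frac{\rho_{\rm cyl}}{|n|}\Big(\frac{\rho_{\rm fil}}{\rho_{\rm cyl}}\Big)^{|n|}$$ (where $x_n\sim y_n$ means $x_n-y_n=o(y_n)$). Moreover, if $J^s,M^s$ is any integrable solution for some auxiliary radii, then for each $n$ with $J_n(k_1\rho^{(1)}_{\rm aux})\neq0$ its $n$-th Fourier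 coefficients are those of the solution above; if $J_n(k_1\rho^{(1)}_{\rm aux})\neq0$ for all $n$, it equals the solution above almost everywhere on $(-\pi,\pi)$. -/

import Mathlib

open Filter Asymptotics MeasureTheory
open scoped Real Topology

noncomputable section

namespace NullField

/-- Bessel function of the first kind of integer order, by Bessel's integral. -/
def besselJ (n : ℤ) (x : ℝ) : ℝ :=
  (1 / π) * ∫ θ in (0 : ℝ)..π, Real.cos (n * θ - x * Real.sin θ)

/-- Bessel function of the second kind (Neumann function) of integer order, by Schläfli's integral;
it is used at arguments `x > 0` only, where both integrals converge absolutely. -/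
def besselY (n : ℤ) (x : ℝ) : ℝ :=
  (1 / π) * (∫ θ in (0 : ℝ)..π, Real.sin (x * Real.sin θ - n * θ))
    - (1 / π) * ∫ t in Set.Ioi (0 : ℝ),
        (Real.exp (n * t) + (-1) ^ n * Real.exp (-(n * t))) * Real.exp (-(x * Real.sinh t))

/-- Hankel function of the second kind, `H_n^{(2)} = J_n - i Y_n`. -/
def hankel2 (n : ℤ) (x : ℝ) : ℂ :=
  (besselJ n x : ℂ) - Complex.I * (besselY n x : ℂ)

/-- Derivative `J_n'` with respect to the argument. -/
def besselJ' (n : ℤ) (x : ℝ) : ℝ := deriv (besselJ n) x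

/-- Derivative `H_n^{(2)}'` with respect to the argument. -/
def hankel2' (n : ℤ) (x : ℝ) : ℂ := deriv (hankel2 n) x

/-- Distance of two points with polar radii `a`, `b` whose polar angles differ by `θ`. -/
def dist2 (a b θ : ℝ) : ℝ := Real.sqrt (a ^ 2 + b ^ 2 - 2 * a * b * Real.cos θ)

/-- The `z`-component of the electric field of a filament of current `I₀` at polar coordinates
`(ρfil, 0)`, in an unbounded medium with wavenumber `k` and impedance `Z`, at `(ρ, φ)`. -/
def incidentField (k Z : ℝ) (I₀ : ℂ) (ρfil ρ φ : ℝ) : ℂ :=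
  -((k * Z / 4 : ℝ) : ℂ) * I₀ * hankel2 0 (k * dist2 ρ ρfil φ)

/-- The `z`-component of the electric field radiated by an electric surface current density `J`
(along `z`) and a magnetic surface current density `M` (along `φ`) on the circle of radius `ρcyl`,
in an unbounded medium with wavenumber `k` and impedance `Z`, at a point `(ρ, φ)` with
`ρ ≠ ρcyl`. -/
def radiatedField (k Z ρcyl : ℝ) (J M : ℝ → ℂ) (ρ φ : ℝ) : ℂ :=
  -((k * Z * ρcyl / 4 : ℝ) : ℂ) *
      (∫ φ' in (-π)..π, J φ' * hankel2 0 (k * dist2 ρcyl ρ (φ' - φ)))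
    + ((k * ρcyl : ℝ) : ℂ) / (4 * Complex.I) *
      (∫ φ' in (-π)..π, M φ' *
        (((ρcyl - ρ * Real.cos (φ' - φ)) / dist2 ρcyl ρ (φ' - φ) : ℝ) : ℂ) *
        hankel2 1 (k * dist2 ρcyl ρ (φ' - φ)))

/-- A dielectric circular cylinder of radius `ρcyl` (region 2) in a homogeneous medium (region 1),
at angular frequency `ω`. -/
structure Cylinder where
  /-- angular frequency -/
  ω : ℝ
  /-- permittivity of region 1 -/
  ε₁ : ℝ
  /-- permeability of region 1 -/
  μ₁ : ℝ
  /-- permittivity of region 2 -/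
  ε₂ : ℝ
  /-- permeability of region 2 -/
  μ₂ : ℝ
  /-- radius of the cylinder -/
  ρcyl : ℝ
  ω_pos : 0 < ω
  ε₁_pos : 0 < ε₁
  μ₁_pos : 0 < μ₁
  ε₂_pos : 0 < ε₂
  μ₂_pos : 0 < μ₂
  ρcyl_pos : 0 < ρcyl

namespace Cylinder

variable (C : Cylinder)

/-- Wavenumber of region 1. -/
def k₁ : ℝ := C.ω * Real.sqrt (C.ε₁ * C.μ₁)

/-- Wavenumber of region 2. -/
def k₂ : ℝ := C.ω * Real.sqrt (C.ε₂ * C.μ₂)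

/-- Impedance of region 1. -/
def Z₁ : ℝ := Real.sqrt (C.μ₁ / C.ε₁)

/-- Impedance of region 2. -/
def Z₂ : ℝ := Real.sqrt (C.μ₂ / C.ε₂)

/-- `J, M` solve the extended integral equations for a filament in region 1 at distance `ρfil` from
the axis. On the circle of radius `ρaux₁` the total field of the first equivalent problem (filament
and `J, M` in medium 1) vanishes; on the circle of radius `ρaux₂` the total field of the second
equivalent problem (`-J, -M` in medium 2) vanishes. -/
structure SolvesExternal (I₀ : ℂ) (ρfil ρaux₁ ρaux₂ : ℝ) (J M : ℝ → ℂ) : Prop where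
  integrable_J : IntervalIntegrable J volume (-π) π
  integrable_M : IntervalIntegrable M volume (-π) π
  first : ∀ φ : ℝ, incidentField C.k₁ C.Z₁ I₀ ρfil ρaux₁ φ
    + radiatedField C.k₁ C.Z₁ C.ρcyl J M ρaux₁ φ = 0
  second : ∀ φ : ℝ,
    radiatedField C.k₂ C.Z₂ C.ρcyl (fun t => -J t) (fun t => -M t) ρaux₂ φ = 0

/-- The same for a filament in region 2: now the filament belongs to the second equivalent
problem. -/
structure SolvesInternal (I₀ : ℂ) (ρfil ρaux₁ ρaux₂ : ℝ) (J M : ℝ → ℂ) : Prop where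
  integrable_J : IntervalIntegrable J volume (-π) π
  integrable_M : IntervalIntegrable M volume (-π) π
  first : ∀ φ : ℝ, radiatedField C.k₁ C.Z₁ C.ρcyl J M ρaux₁ φ = 0
  second : ∀ φ : ℝ, incidentField C.k₂ C.Z₂ I₀ ρfil ρaux₂ φ
    + radiatedField C.k₂ C.Z₂ C.ρcyl (fun t => -J t) (fun t => -M t) ρaux₂ φ = 0

/-- `Δ_n = Z₁ H_n(k₁ρcyl) J_n'(k₂ρcyl) - Z₂ H_n'(k₁ρcyl) J_n(k₂ρcyl)`. -/
def denom (n : ℤ) : ℂ :=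
  C.Z₁ * hankel2 n (C.k₁ * C.ρcyl) * besselJ' n (C.k₂ * C.ρcyl)
    - C.Z₂ * hankel2' n (C.k₁ * C.ρcyl) * besselJ n (C.k₂ * C.ρcyl)

/-- Coefficients of the series for `J`, external excitation. -/
def extJ (ρfil : ℝ) (n : ℤ) : ℂ :=
  C.Z₁ * hankel2 n (C.k₁ * ρfil) * besselJ' n (C.k₂ * C.ρcyl) / C.denom n

/-- Coefficients of the series for `M`, external excitation. -/
def extM (ρfil : ℝ) (n : ℤ) : ℂ :=
  Complex.I * C.Z₁ * C.Z₂ * hankel2 n (C.k₁ * ρfil) * besselJ n (C.k₂ * C.ρcyl) / C.denom n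

/-- Coefficients of the series for `J`, internal excitation; the denominator is
`-Δ_n = Z₂ J_n(k₂ρcyl) H_n'(k₁ρcyl) - Z₁ J_n'(k₂ρcyl) H_n(k₁ρcyl)`. -/
def intJ (ρfil : ℝ) (n : ℤ) : ℂ :=
  C.Z₂ * besselJ n (C.k₂ * ρfil) * hankel2' n (C.k₁ * C.ρcyl) / (-C.denom n)

/-- Coefficients of the series for `M`, internal excitation. -/
def intM (ρfil : ℝ) (n : ℤ) : ℂ :=
  Complex.I * C.Z₁ * C.Z₂ * besselJ n (C.k₂ * ρfil) * hankel2 n (C.k₁ * C.ρcyl) / (-C.denom n)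

/-- The prefactor `I₀ / (2πρcyl)`. -/
def amp (I₀ : ℂ) : ℂ := I₀ / ((2 * π * C.ρcyl : ℝ) : ℂ)

end Cylinder

/-- The Fourier series `φ ↦ ∑_{n ∈ ℤ} c_n e^{inφ}`. -/
def fourierSum (c : ℤ → ℂ) (φ : ℝ) : ℂ := ∑' n : ℤ, c n * Complex.exp (Complex.I * n * φ)

end NullField

end

open NullField

/-!
# Null-field equations for a dielectric cylinder excited by a filament

The system is diagonal in Fourier modes, and everything follows from three facts about
`H_n = J_n - i Y_n`, all of which are obtained from one contour integral.

*Contour integral.* For `x > 0`, `H_n(x)` is `(1 / π i)` times the integral of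
`exp (n w - x sinh w)` over the contour `+∞ → 0 → iπ → -∞ + iπ` (`hankel2_eq_sommerfeld`). More
generally `sommerfeld n p q` is the same integral of `exp (n w - p e^w + q e^{-w})`.
Differentiation in the parameters and the vanishing of the integral of an exact derivative give
the recurrences for `H_n`, and their real parts those for `J_n`. Moreover
`sommerfeld 0 (z / 2) (z̄ / 2)` depends only on `|z|` when `0 < re z`
(`sommerfeld_zero_eq_hankel2`): rotating `z` shifts the contour.

*Addition theorem.* The distance of two points is `|z|` with `z = b - a e^{iθ}`. Since `0 < re z`
for `a < b`, the contour integral for `H_0(|z|)` can be integrated against `e^{-inθ}` under the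
integral sign, and the inner integral is the generating function of the Bessel functions. This
gives Graf's addition theorem `fourierInt_electricKernel`: the `n`-th Fourier coefficient of
`θ ↦ H_0(|z|)` is `2π J_n(a) H_n(b)`. The kernel of the magnetic current is a derivative of the
electric one with respect to the radius, so that its coefficients are found by differentiation.

*Large orders.* `J_n(x) ~ (x/2)^n / n!` by induction on `n` with an explicit error bound
(`abs_besselJ_sub_le`), and `H_n(x) ~ (i/π) (n-1)! (2/x)^n` because one of the two half-line
integrals dominates, and that integral is explicit for `q = 0` (`tailIntegral_zero_right`). The
cross product `J_{n+1} H_n - J_n H_{n+1}` is independent of `n` by the recurrences, hence equal to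
its limit; this is the Wronskian (`besselJ_hankel2_wronskian`).

The Wronskian shows `H_n ≠ 0`, that `J_n` and `J_n'` have no common zero, and that `Δ_n ≠ 0`
(`Cylinder.denom_ne_zero`). The asymptotics of the coefficients, and with them the absolute
convergence of the series, come from those of the Bessel functions for `n → +∞`; all coefficients
are even in `n`.

A continuous periodic function vanishes if and only if its Fourier coefficients do, and the
radiated fields are convolutions. Hence the two integral equations are equivalent, mode by mode,
to `J_n(k₁ρ₁) · innerMode = 0` and `outerMode = 0`, where `innerMode` and `outerMode` are affine
in the two Fourier coefficients of the densities and do not involve the auxiliary radii. The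
determinant of this pair is a nonzero multiple of `Δ_n`. The stated series satisfy both equations,
and any other solution agrees with them in every mode with `J_n(k₁ρ₁) ≠ 0`. If there is no
exceptional mode, the densities agree almost everywhere, as an integrable function is determined
by its Fourier coefficients (`ae_eq_zero_of_fourierInt_eq_zero`).
-/

namespace NullField

/-! ### Parametric integrals over a compact interval -/

/-- Differentiation under the integral sign over a compact interval: joint continuity of the
derivative near the base point supplies the dominating constant. -/
theorem hasDerivAt_intervalIntegral_of_continuousOn {F F' : ℝ → ℝ → ℂ} {U : Set ℝ} {x₀ a b : ℝ}
    (hU : U ∈ 𝓝 x₀) (hF : ∀ x ∈ U, Continuous (F x))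
    (hd : ∀ x ∈ U, ∀ t, HasDerivAt (fun y => F y t) (F' x t) x)
    (hF' : ContinuousOn (fun z : ℝ × ℝ => F' z.1 z.2) (U ×ˢ Set.univ)) :
    HasDerivAt (fun x => ∫ t in a..b, F x t) (∫ t in a..b, F' x₀ t) x₀ := by
  obtain ⟨ε, hε, hball⟩ := Metric.nhds_basis_closedBall.mem_iff.1 hU
  have hK : IsCompact (Metric.closedBall x₀ ε ×ˢ Set.uIcc a b) :=
    (isCompact_closedBall x₀ ε).prod isCompact_uIcc
  obtain ⟨B, hB⟩ := hK.exists_bound_of_continuousOn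
    (hF'.mono (Set.prod_mono hball (Set.subset_univ _)))
  have hx₀ : x₀ ∈ U := mem_of_mem_nhds hU
  have hc : Continuous (F' x₀) := by
    rw [← continuousOn_univ]
    exact hF'.comp (f := fun t => (x₀, t)) (by fun_prop) (fun t _ => ⟨hx₀, trivial⟩)
  refine (intervalIntegral.hasDerivAt_integral_of_dominated_loc_of_deriv_le (bound := fun _ => B)
    (Metric.closedBall_mem_nhds x₀ hε) ?_ ((hF x₀ hx₀).intervalIntegrable _ _)
    hc.aestronglyMeasurable ?_ intervalIntegrable_const ?_).2
  · filter_upwards [hU] with x hx using (hF x hx).aestronglyMeasurable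
  · refine Eventually.of_forall fun t ht x hx => hB (x, t) ⟨hx, Set.uIoc_subset_uIcc ht⟩
  · exact Eventually.of_forall fun t _ x hx => hd x (hball hx) t

/-! ### Sommerfeld-type contour integrals -/

/-- The integrand `exp (n w - p e^w + q e^{-w})` of the contour integrals. For `p = q = x / 2` it is
`exp (n w - x sinh w)`. -/
noncomputable def contourIntegrand (n : ℤ) (p q w : ℂ) : ℂ :=
  Complex.exp (n * w - p * Complex.exp w + q * Complex.exp (-w))

/-- The integral of `contourIntegrand n p q` over the half-line `w = t`, `t > 0`. -/
noncomputable def tailIntegral (n : ℤ) (p q : ℂ) : ℂ :=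
  ∫ t in Set.Ioi (0 : ℝ), contourIntegrand n p q t

/-- The integral of `contourIntegrand n p q` over the segment `w = i s`, `0 < s < π`, with respect
to `s`. -/
noncomputable def arcIntegral (n : ℤ) (p q : ℂ) : ℂ :=
  ∫ s in (0 : ℝ)..π, contourIntegrand n p q (Complex.I * s)

/-- The integral `(1 / π i) ∫ exp (n w - p e^w + q e^{-w}) dw` over the contour that runs from `+∞`
to `0`, then to `i π`, then to `-∞ + i π`; the last piece is folded back to the positive half-line,
which swaps `p` and `q`. -/
noncomputable def sommerfeld (n : ℤ) (p q : ℂ) : ℂ :=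
  (1 / π : ℂ) * (arcIntegral n p q + Complex.I * tailIntegral n p q
    + Complex.I * ((-1) ^ n * tailIntegral (-n) q p))

theorem contourIntegrand_add_one (n : ℤ) (p q w : ℂ) :
    contourIntegrand (n + 1) p q w = Complex.exp w * contourIntegrand n p q w := by
  rw [contourIntegrand, contourIntegrand, ← Complex.exp_add]
  congr 1; push_cast; ring

theorem contourIntegrand_sub_one (n : ℤ) (p q w : ℂ) :
    contourIntegrand (n - 1) p q w = Complex.exp (-w) * contourIntegrand n p q w := by
  rw [contourIntegrand, contourIntegrand, ← Complex.exp_add]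
  congr 1; push_cast; ring

@[fun_prop]
theorem continuous_contourIntegrand (n : ℤ) {X : Type*} [TopologicalSpace X] {p q w : X → ℂ}
    (hp : Continuous p) (hq : Continuous q) (hw : Continuous w) :
    Continuous fun x => contourIntegrand n (p x) (q x) (w x) := by
  unfold contourIntegrand; fun_prop

theorem hasDerivAt_contourIntegrand (n : ℤ) (p q w : ℂ) :
    HasDerivAt (contourIntegrand n p q)
      (n * contourIntegrand n p q w - p * contourIntegrand (n + 1) p q w
        - q * contourIntegrand (n - 1) p q w) w := by
  rw [contourIntegrand_add_one, contourIntegrand_sub_one]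
  have h : HasDerivAt (fun w : ℂ => (n : ℂ) * w - p * Complex.exp w + q * Complex.exp (-w))
      (n * 1 - p * Complex.exp w + q * (Complex.exp (-w) * (-1))) w :=
    (((hasDerivAt_id w).const_mul _).sub ((Complex.hasDerivAt_exp w).const_mul p)).add
      (((hasDerivAt_id w).neg.cexp).const_mul q)
  refine h.cexp.congr_deriv ?_
  simp only [contourIntegrand]; ring

/-- The derivative of the integrand along a curve of parameters. -/
theorem hasDerivAt_contourIntegrand_param (n : ℤ) {p q : ℝ → ℂ} {p' q' : ℂ} {x : ℝ} (w : ℂ)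
    (hp : HasDerivAt p p' x) (hq : HasDerivAt q q' x) :
    HasDerivAt (fun y => contourIntegrand n (p y) (q y) w)
      (-p' * contourIntegrand (n + 1) (p x) (q x) w
        + q' * contourIntegrand (n - 1) (p x) (q x) w) x := by
  rw [contourIntegrand_add_one, contourIntegrand_sub_one]
  have h := (((hp.mul_const (Complex.exp w)).const_sub ((n : ℂ) * w)).add
    (hq.mul_const (Complex.exp (-w)))).cexp
  refine HasDerivAt.congr_deriv h ?_
  simp only [contourIntegrand, Pi.add_apply]; ring

theorem exp_sub_mul_exp_le {N c t : ℝ} (hc : 0 < c) (ht : 0 ≤ t) :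
    Real.exp (N * t - c * Real.exp t) ≤ Real.exp ((N + 1) ^ 2 / (2 * c)) * Real.exp (-1 * t) := by
  rw [← Real.exp_add]
  apply Real.exp_le_exp.2
  have h1 : t ^ 2 / 2 ≤ Real.exp t := by
    have := Real.quadratic_le_exp_of_nonneg ht; nlinarith
  have h2 : c * (t ^ 2 / 2) ≤ c * Real.exp t := by gcongr
  have h3 : (N + 1) * t ≤ (N + 1) ^ 2 / (2 * c) + c * (t ^ 2 / 2) := by
    have : (N + 1) ^ 2 / (2 * c) + c * (t ^ 2 / 2) - (N + 1) * t
        = ((N + 1) - c * t) ^ 2 / (2 * c) := by field_simp; ring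
    have h4 : 0 ≤ ((N + 1) - c * t) ^ 2 / (2 * c) := by positivity
    linarith
  linarith

theorem integrableOn_exp_sub_mul_exp (N : ℝ) {c : ℝ} (hc : 0 < c) :
    IntegrableOn (fun t => Real.exp (N * t - c * Real.exp t)) (Set.Ioi 0) := by
  refine integrable_of_isBigO_exp_neg (b := 1) one_pos (by fun_prop) ?_
  refine IsBigO.of_bound (Real.exp ((N + 1) ^ 2 / (2 * c))) ?_
  filter_upwards [eventually_ge_atTop 0] with t ht
  simpa [abs_of_nonneg (Real.exp_pos _).le] using exp_sub_mul_exp_le (N := N) hc ht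

/-- The bound that dominates all integrals over the half-line. -/
theorem norm_contourIntegrand_le (n : ℤ) {p q : ℂ} {c M t : ℝ} (hp : c ≤ p.re) (hq : ‖q‖ ≤ M)
    (ht : 0 ≤ t) :
    ‖contourIntegrand n p q t‖ ≤ Real.exp M * Real.exp (n * t - c * Real.exp t) := by
  rw [contourIntegrand, Complex.norm_exp, ← Real.exp_add]
  apply Real.exp_le_exp.2
  have h1 : (p * Complex.exp t).re = p.re * Real.exp t := by
    rw [← Complex.ofReal_exp, Complex.re_mul_ofReal]
  have h2 : (q * Complex.exp (-t)).re = q.re * Real.exp (-t) := by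
    rw [← Complex.ofReal_neg, ← Complex.ofReal_exp, Complex.re_mul_ofReal]
  have h3 : ((n : ℂ) * t).re = n * t := by
    rw [← Complex.ofReal_intCast, Complex.re_ofReal_mul, Complex.ofReal_re]
  rw [Complex.add_re, Complex.sub_re, h1, h2, h3]
  have h4 : c * Real.exp t ≤ p.re * Real.exp t := by gcongr
  have h5 : q.re * Real.exp (-t) ≤ M := by
    calc q.re * Real.exp (-t) ≤ ‖q‖ * Real.exp (-t) := by gcongr; exact Complex.re_le_norm q
      _ ≤ ‖q‖ * 1 := by gcongr; exact Real.exp_le_one_iff.2 (by linarith)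
      _ ≤ M := by linarith
  linarith

theorem integrableOn_contourIntegrand (n : ℤ) {p : ℂ} (q : ℂ) (hp : 0 < p.re) :
    IntegrableOn (fun t : ℝ => contourIntegrand n p q t) (Set.Ioi 0) := by
  refine Integrable.mono' ((integrableOn_exp_sub_mul_exp n hp).const_mul (Real.exp ‖q‖))
    (Continuous.aestronglyMeasurable (by fun_prop)) ?_
  refine (ae_restrict_mem measurableSet_Ioi).mono fun t ht => ?_
  exact norm_contourIntegrand_le n le_rfl le_rfl (le_of_lt ht)

theorem hasDerivAt_tailIntegral (n : ℤ) {p q p' q' : ℝ → ℂ} {x : ℝ}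
    (hp : ∀ y, HasDerivAt p (p' y) y) (hq : ∀ y, HasDerivAt q (q' y) y)
    (hp' : Continuous p') (hq' : Continuous q') (hx : 0 < (p x).re) :
    HasDerivAt (fun y => tailIntegral n (p y) (q y))
      (-p' x * tailIntegral (n + 1) (p x) (q x) + q' x * tailIntegral (n - 1) (p x) (q x)) x := by
  have hpc : Continuous p := continuous_iff_continuousAt.2 fun y => (hp y).continuousAt
  have hqc : Continuous q := continuous_iff_continuousAt.2 fun y => (hq y).continuousAt
  set c := (p x).re / 2 with hc
  have hc0 : 0 < c := by positivity
  set s : Set ℝ := {y | c < (p y).re ∧ ‖q y‖ < ‖q x‖ + 1 ∧ ‖p' y‖ < ‖p' x‖ + 1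
    ∧ ‖q' y‖ < ‖q' x‖ + 1} with hs
  have hs_nhds : s ∈ 𝓝 x := by
    refine IsOpen.mem_nhds ?_ ⟨by simp only [hc]; linarith, by linarith, by linarith, by linarith⟩
    exact (isOpen_lt continuous_const (Complex.continuous_re.comp hpc)).inter
      ((isOpen_lt hqc.norm continuous_const).inter
      ((isOpen_lt hp'.norm continuous_const).inter (isOpen_lt hq'.norm continuous_const)))
  set M := ‖q x‖ + 1
  have key := (hasDerivAt_integral_of_dominated_loc_of_deriv_le
    (μ := volume.restrict (Set.Ioi (0 : ℝ)))
    (F := fun y (t : ℝ) => contourIntegrand n (p y) (q y) t)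
    (F' := fun y (t : ℝ) => -p' y * contourIntegrand (n + 1) (p y) (q y) t
        + q' y * contourIntegrand (n - 1) (p y) (q y) t)
    (bound := fun t => (‖p' x‖ + 1) *
        (Real.exp M * Real.exp ((n + 1 : ℤ) * t - c * Real.exp t))
      + (‖q' x‖ + 1) * (Real.exp M * Real.exp ((n - 1 : ℤ) * t - c * Real.exp t)))
    hs_nhds ?_ (integrableOn_contourIntegrand n _ hx) ?_ ?_ ?_ ?_).2
  · refine HasDerivAt.congr_deriv key ?_
    rw [integral_add ((integrableOn_contourIntegrand _ _ hx).const_mul _)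
      ((integrableOn_contourIntegrand _ _ hx).const_mul _), integral_const_mul, integral_const_mul]
    rfl
  · exact Eventually.of_forall fun y => Continuous.aestronglyMeasurable (by fun_prop)
  · exact Continuous.aestronglyMeasurable (by fun_prop)
  · refine (ae_restrict_mem measurableSet_Ioi).mono fun t ht y hy => ?_
    obtain ⟨h1, h2, h3, h4⟩ := hy
    refine (norm_add_le _ _).trans ?_
    rw [norm_mul, norm_mul, norm_neg]
    gcongr
    · exact norm_contourIntegrand_le _ h1.le h2.le (le_of_lt ht)
    · exact norm_contourIntegrand_le _ h1.le h2.le (le_of_lt ht)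
  · exact (((integrableOn_exp_sub_mul_exp _ hc0).const_mul _).const_mul _).add
      (((integrableOn_exp_sub_mul_exp _ hc0).const_mul _).const_mul _)
  · exact Eventually.of_forall fun t y _ => hasDerivAt_contourIntegrand_param n _ (hp y) (hq y)

theorem hasDerivAt_arcIntegral (n : ℤ) {p q p' q' : ℝ → ℂ} {x : ℝ}
    (hp : ∀ y, HasDerivAt p (p' y) y) (hq : ∀ y, HasDerivAt q (q' y) y)
    (hp' : Continuous p') (hq' : Continuous q') :
    HasDerivAt (fun y => arcIntegral n (p y) (q y))
      (-p' x * arcIntegral (n + 1) (p x) (q x) + q' x * arcIntegral (n - 1) (p x) (q x)) x := by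
  have hpc : Continuous p := continuous_iff_continuousAt.2 fun y => (hp y).continuousAt
  have hqc : Continuous q := continuous_iff_continuousAt.2 fun y => (hq y).continuousAt
  have key := hasDerivAt_intervalIntegral_of_continuousOn (a := 0) (b := π) (x₀ := x)
    (F := fun y (t : ℝ) => contourIntegrand n (p y) (q y) (Complex.I * t))
    (F' := fun y (t : ℝ) => -p' y * contourIntegrand (n + 1) (p y) (q y) (Complex.I * t)
        + q' y * contourIntegrand (n - 1) (p y) (q y) (Complex.I * t)) univ_mem
    (fun y _ => by fun_prop)
    (fun y _ t => hasDerivAt_contourIntegrand_param n _ (hp y) (hq y))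
    (Continuous.continuousOn (by fun_prop))
  refine HasDerivAt.congr_deriv key ?_
  rw [intervalIntegral.integral_add (Continuous.intervalIntegrable (by fun_prop) _ _)
    (Continuous.intervalIntegrable (by fun_prop) _ _), intervalIntegral.integral_const_mul,
    intervalIntegral.integral_const_mul]
  rfl

theorem hasDerivAt_sommerfeld (n : ℤ) {p q p' q' : ℝ → ℂ} {x : ℝ}
    (hp : ∀ y, HasDerivAt p (p' y) y) (hq : ∀ y, HasDerivAt q (q' y) y)
    (hp' : Continuous p') (hq' : Continuous q') (hx : 0 < (p x).re) (hx' : 0 < (q x).re) :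
    HasDerivAt (fun y => sommerfeld n (p y) (q y))
      (-p' x * sommerfeld (n + 1) (p x) (q x) + q' x * sommerfeld (n - 1) (p x) (q x)) x := by
  have h := (((hasDerivAt_arcIntegral (x := x) n hp hq hp' hq').add
    ((hasDerivAt_tailIntegral n hp hq hp' hq' hx).const_mul Complex.I)).add
    (((hasDerivAt_tailIntegral (-n) hq hp hq' hp' hx').const_mul ((-1 : ℂ) ^ n)).const_mul
      Complex.I)).const_mul (1 / π : ℂ)
  refine HasDerivAt.congr_deriv h ?_
  have e1 : (-1 : ℂ) ^ (n + 1) = -(-1) ^ n := by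
    rw [zpow_add₀ (by norm_num)]; simp
  have e2 : (-1 : ℂ) ^ (n - 1) = -(-1) ^ n := by
    rw [zpow_sub₀ (by norm_num), zpow_one, div_neg, div_one]
  have e3 : -(n - 1) = -n + 1 := by ring
  have e4 : -(n + 1) = -n - 1 := by ring
  simp only [sommerfeld, e1, e2, e3, e4]
  ring

theorem tendsto_contourIntegrand_atTop (n : ℤ) {p : ℂ} (q : ℂ) (hp : 0 < p.re) :
    Tendsto (fun t : ℝ => contourIntegrand n p q t) atTop (𝓝 0) := by
  have h1 : Tendsto (fun t : ℝ => Real.exp ‖q‖ * (Real.exp ((n + 1 : ℝ) ^ 2 / (2 * p.re))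
      * Real.exp (-1 * t))) atTop (𝓝 0) := by
    have : Tendsto (fun t : ℝ => Real.exp (-1 * t)) atTop (𝓝 0) := by
      simpa using Real.tendsto_exp_neg_atTop_nhds_zero
    simpa using (this.const_mul (Real.exp ((n + 1 : ℝ) ^ 2 / (2 * p.re)))).const_mul (Real.exp ‖q‖)
  refine squeeze_zero_norm' ?_ h1
  filter_upwards [eventually_ge_atTop 0] with t ht
  refine (norm_contourIntegrand_le n le_rfl le_rfl ht).trans ?_
  gcongr
  exact exp_sub_mul_exp_le hp ht

theorem tailIntegral_recurrence (n : ℤ) {p : ℂ} (q : ℂ) (hp : 0 < p.re) :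
    n * tailIntegral n p q - p * tailIntegral (n + 1) p q - q * tailIntegral (n - 1) p q
      = -Complex.exp (q - p) := by
  have i0 := integrableOn_contourIntegrand n q hp
  have i1 := integrableOn_contourIntegrand (n + 1) q hp
  have i2 := integrableOn_contourIntegrand (n - 1) q hp
  have h := integral_Ioi_of_hasDerivAt_of_tendsto' (a := 0)
    (f := fun t : ℝ => contourIntegrand n p q t)
    (fun t _ => (hasDerivAt_contourIntegrand n p q t).comp_ofReal)
    (((i0.const_mul (n : ℂ)).sub (i1.const_mul p)).sub (i2.const_mul q))
    (tendsto_contourIntegrand_atTop n q hp)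
  rw [integral_sub (by exact (i0.const_mul (n : ℂ)).sub (i1.const_mul p)) (i2.const_mul q),
    integral_sub (i0.const_mul (n : ℂ)) (i1.const_mul p), integral_const_mul, integral_const_mul,
    integral_const_mul] at h
  simp only [tailIntegral]
  rw [h]
  simp [contourIntegrand, neg_add_eq_sub]

theorem exp_int_mul_I_mul_pi (n : ℤ) : Complex.exp (n * (Complex.I * π)) = (-1) ^ n := by
  rw [mul_comm Complex.I, Complex.exp_int_mul, Complex.exp_pi_mul_I]

theorem arcIntegral_recurrence (n : ℤ) (p q : ℂ) :
    n * arcIntegral n p q - p * arcIntegral (n + 1) p q - q * arcIntegral (n - 1) p q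
      = -Complex.I * ((-1) ^ n * Complex.exp (p - q) - Complex.exp (q - p)) := by
  have hd : ∀ s : ℝ, HasDerivAt (fun s : ℝ => contourIntegrand n p q (Complex.I * s))
      (Complex.I * (n * contourIntegrand n p q (Complex.I * s)
        - p * contourIntegrand (n + 1) p q (Complex.I * s)
        - q * contourIntegrand (n - 1) p q (Complex.I * s))) s := by
    intro s
    have h1 : HasDerivAt (fun s : ℝ => Complex.I * (s : ℂ)) (Complex.I * 1) s :=
      (Complex.ofRealCLM.hasDerivAt (x := s)).const_mul Complex.I
    have := (hasDerivAt_contourIntegrand n p q (Complex.I * s)).comp s h1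
    exact this.congr_deriv (by ring)
  have h := intervalIntegral.integral_eq_sub_of_hasDerivAt (a := 0) (b := π)
    (fun s _ => hd s) (Continuous.intervalIntegrable (by fun_prop) _ _)
  have i : ∀ m : ℤ, ∀ c : ℂ, IntervalIntegrable
      (fun s : ℝ => c * contourIntegrand m p q (Complex.I * s)) volume 0 π :=
    fun m c => Continuous.intervalIntegrable (by fun_prop) _ _
  rw [intervalIntegral.integral_const_mul, intervalIntegral.integral_sub ((i _ _).sub (i _ _))
    (i _ _), intervalIntegral.integral_sub (i _ _) (i _ _), intervalIntegral.integral_const_mul,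
    intervalIntegral.integral_const_mul, intervalIntegral.integral_const_mul] at h
  have e1 : contourIntegrand n p q (Complex.I * π) = (-1) ^ n * Complex.exp (p - q) := by
    rw [contourIntegrand, Complex.exp_neg, mul_comm Complex.I, Complex.exp_pi_mul_I,
      mul_comm (π : ℂ), ← exp_int_mul_I_mul_pi, ← Complex.exp_add]
    congr 1; norm_num; ring
  have e0 : contourIntegrand n p q (Complex.I * (0 : ℝ)) = Complex.exp (q - p) := by
    simp [contourIntegrand, neg_add_eq_sub]
  rw [e1, e0] at h
  simp only [arcIntegral]
  rw [← h, ← mul_assoc]; simp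

/-- The contour integral of the derivative of `exp (n w - p e^w + q e^{-w})` vanishes. -/
theorem sommerfeld_recurrence (n : ℤ) {p q : ℂ} (hp : 0 < p.re) (hq : 0 < q.re) :
    p * sommerfeld (n + 1) p q + q * sommerfeld (n - 1) p q = n * sommerfeld n p q := by
  have h1 := arcIntegral_recurrence n p q
  have h2 := tailIntegral_recurrence n q hp
  have h3 := tailIntegral_recurrence (-n) p hq
  have e1 : (-1 : ℂ) ^ (n + 1) = -(-1) ^ n := by
    rw [zpow_add₀ (by norm_num)]; simp
  have e2 : (-1 : ℂ) ^ (n - 1) = -(-1) ^ n := by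
    rw [zpow_sub₀ (by norm_num), zpow_one, div_neg, div_one]
  have e3 : -(n - 1) = -n + 1 := by ring
  have e4 : -(n + 1) = -n - 1 := by ring
  simp only [sommerfeld, e1, e2, e3, e4]
  push_cast at h3
  linear_combination (-1 / π : ℂ) * h1 - (Complex.I / π) * h2
    + (Complex.I / π * (-1) ^ n) * h3

/-! ### The Hankel functions as contour integrals -/

theorem contourIntegrand_half (n : ℤ) (x t : ℝ) :
    contourIntegrand n (x / 2) (x / 2) t
      = ((Real.exp (n * t) * Real.exp (-(x * Real.sinh t)) : ℝ) : ℂ) := by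
  rw [contourIntegrand, ← Real.exp_add, Real.sinh_eq]
  push_cast
  congr 1; ring

theorem contourIntegrand_half_arc (n : ℤ) (x s : ℝ) :
    contourIntegrand n (x / 2) (x / 2) (Complex.I * s)
      = (Real.cos (n * s - x * Real.sin s) : ℂ)
        - Complex.I * (Real.sin (x * Real.sin s - n * s) : ℂ) := by
  rw [contourIntegrand]
  have h1 : Complex.exp (Complex.I * s) = Complex.cos s + Complex.sin s * Complex.I := by
    rw [mul_comm, Complex.exp_mul_I]
  have h2 : Complex.exp (-(Complex.I * s)) = Complex.cos s - Complex.sin s * Complex.I := by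
    rw [mul_comm, ← neg_mul, Complex.exp_mul_I]; simp; ring
  have h3 : (n : ℂ) * (Complex.I * s) - x / 2 * Complex.exp (Complex.I * s)
      + x / 2 * Complex.exp (-(Complex.I * s))
      = ((n * s - x * Real.sin s : ℝ) : ℂ) * Complex.I := by
    rw [h1, h2]; push_cast; ring
  rw [h3, Complex.exp_mul_I, show x * Real.sin s - n * s = -(n * s - x * Real.sin s) by ring,
    Real.sin_neg]
  push_cast; ring

theorem hankel2_eq_sommerfeld (n : ℤ) {x : ℝ} (hx : 0 < x) :
    hankel2 n x = sommerfeld n (x / 2) (x / 2) := by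
  have hre : 0 < ((x : ℂ) / 2).re := by simpa using hx
  have hA : arcIntegral n (x / 2) (x / 2)
      = ((∫ θ in (0 : ℝ)..π, Real.cos (n * θ - x * Real.sin θ) : ℝ) : ℂ)
        - Complex.I * ((∫ θ in (0 : ℝ)..π, Real.sin (x * Real.sin θ - n * θ) : ℝ) : ℂ) := by
    rw [arcIntegral]
    simp only [contourIntegrand_half_arc]
    rw [intervalIntegral.integral_sub (Continuous.intervalIntegrable (by fun_prop) _ _)
      (Continuous.intervalIntegrable (by fun_prop) _ _), intervalIntegral.integral_const_mul,
      intervalIntegral.integral_ofReal, intervalIntegral.integral_ofReal]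
  have hint : ∀ m : ℤ, IntegrableOn
      (fun t => Real.exp (m * t) * Real.exp (-(x * Real.sinh t))) (Set.Ioi 0) := by
    intro m
    have := (integrableOn_contourIntegrand m (x / 2) hre).re
    simp only [contourIntegrand_half, RCLike.re_eq_complex_re, Complex.ofReal_re] at this
    exact this
  have hT : ∀ m : ℤ, tailIntegral m (x / 2) (x / 2)
      = ((∫ t in Set.Ioi (0 : ℝ), Real.exp (m * t) * Real.exp (-(x * Real.sinh t)) : ℝ) : ℂ) := by
    intro m
    rw [tailIntegral]
    simp only [contourIntegrand_half]
    exact integral_ofReal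
  have hY : (∫ t in Set.Ioi (0 : ℝ),
      (Real.exp (n * t) + (-1) ^ n * Real.exp (-(n * t))) * Real.exp (-(x * Real.sinh t)))
      = (∫ t in Set.Ioi (0 : ℝ), Real.exp (n * t) * Real.exp (-(x * Real.sinh t)))
        + (-1) ^ n * ∫ t in Set.Ioi (0 : ℝ),
            Real.exp ((-n : ℤ) * t) * Real.exp (-(x * Real.sinh t)) := by
    rw [← integral_const_mul, ← integral_add (hint n) ((hint (-n)).const_mul _)]
    congr 1; ext t
    push_cast
    rw [neg_mul]; ring
  rw [hankel2, besselJ, besselY, sommerfeld, hA, hT, hT, hY]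
  push_cast
  ring

theorem hasDerivAt_hankel2 (n : ℤ) {x : ℝ} (hx : 0 < x) :
    HasDerivAt (hankel2 n) ((hankel2 (n - 1) x - hankel2 (n + 1) x) / 2) x := by
  have hre : 0 < ((x : ℂ) / 2).re := by simpa using hx
  have hd : ∀ y : ℝ, HasDerivAt (fun y : ℝ => (y : ℂ) / 2) (1 / 2) y := fun y =>
    (Complex.ofRealCLM.hasDerivAt (x := y)).div_const 2
  have h := hasDerivAt_sommerfeld n (x := x) hd hd continuous_const continuous_const hre hre
  rw [← hankel2_eq_sommerfeld _ hx, ← hankel2_eq_sommerfeld _ hx] at h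
  refine (h.congr_of_eventuallyEq ?_).congr_deriv (by ring)
  filter_upwards [lt_mem_nhds hx] with y hy using hankel2_eq_sommerfeld n hy

theorem hankel2_recurrence (n : ℤ) {x : ℝ} (hx : 0 < x) :
    hankel2 (n - 1) x + hankel2 (n + 1) x = 2 * n / x * hankel2 n x := by
  have hre : 0 < ((x : ℂ) / 2).re := by simpa using hx
  have h := sommerfeld_recurrence n hre hre
  simp only [← hankel2_eq_sommerfeld _ hx] at h
  have hx' : (x : ℂ) ≠ 0 := by exact_mod_cast hx.ne'
  field_simp
  linear_combination 2 * h

/-- Moving `(p, q)` along `(z e^{iα}, z̄ e^{-iα})` shifts the contour by `iα`, which does not change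
the integral as long as both parameters stay in the right half-plane. -/
theorem sommerfeld_zero_eq_hankel2 {z : ℂ} (hz : 0 < z.re) :
    sommerfeld 0 (z / 2) ((starRingEnd ℂ) z / 2) = hankel2 0 ‖z‖ := by
  have hz0 : z ≠ 0 := by rintro rfl; simp at hz
  have hn : 0 < ‖z‖ := norm_pos_iff.2 hz0
  set r := ‖z‖ with hr
  set p : ℝ → ℂ := fun α => r / 2 * Complex.exp (α * Complex.I) with hpdef
  set q : ℝ → ℂ := fun α => r / 2 * Complex.exp (-(α * Complex.I)) with hqdef
  have hp : ∀ y, HasDerivAt p (Complex.I * p y) y := by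
    intro y
    have h1 : HasDerivAt (fun y : ℝ => (y : ℂ) * Complex.I) (1 * Complex.I) y :=
      (Complex.ofRealCLM.hasDerivAt (x := y)).mul_const _
    refine (h1.cexp.const_mul ((r : ℂ) / 2)).congr_deriv ?_
    simp only [hpdef]; ring
  have hq : ∀ y, HasDerivAt q (-Complex.I * q y) y := by
    intro y
    have h1 : HasDerivAt (fun y : ℝ => -((y : ℂ) * Complex.I)) (-(1 * Complex.I)) y :=
      ((Complex.ofRealCLM.hasDerivAt (x := y)).mul_const _).neg
    refine (h1.cexp.const_mul ((r : ℂ) / 2)).congr_deriv ?_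
    simp only [hqdef]; ring
  have hpre : ∀ y, (p y).re = r / 2 * Real.cos y := by
    intro y
    have : (r : ℂ) / 2 = ((r / 2 : ℝ) : ℂ) := by push_cast; ring
    simp only [hpdef, this, Complex.re_ofReal_mul, Complex.exp_ofReal_mul_I_re]
  have hqre : ∀ y, (q y).re = r / 2 * Real.cos y := by
    intro y
    have : (r : ℂ) / 2 = ((r / 2 : ℝ) : ℂ) := by push_cast; ring
    have h2 : -((y : ℂ) * Complex.I) = ((-y : ℝ) : ℂ) * Complex.I := by push_cast; ring
    simp only [hqdef, this, h2, Complex.re_ofReal_mul, Complex.exp_ofReal_mul_I_re, Real.cos_neg]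
  have hcp : Continuous p := by simp only [hpdef]; fun_prop
  have hcq : Continuous q := by simp only [hqdef]; fun_prop
  have hd : ∀ y ∈ Set.Ioo (-(π / 2)) (π / 2),
      HasDerivAt (fun y => sommerfeld 0 (p y) (q y)) 0 y := by
    intro y hy
    have hc : 0 < r / 2 * Real.cos y := mul_pos (by positivity) (Real.cos_pos_of_mem_Ioo hy)
    have h := hasDerivAt_sommerfeld 0 (x := y) hp hq (by fun_prop) (by fun_prop)
      (by rw [hpre]; exact hc) (by rw [hqre]; exact hc)
    have h0 := sommerfeld_recurrence 0 (p := p y) (q := q y) (by rw [hpre]; exact hc)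
      (by rw [hqre]; exact hc)
    refine h.congr_deriv ?_
    rw [Int.cast_zero, zero_mul] at h0
    linear_combination -Complex.I * h0
  have hconst : ∀ x ∈ Set.Ioo (-(π / 2)) (π / 2), ∀ y ∈ Set.Ioo (-(π / 2)) (π / 2),
      sommerfeld 0 (p x) (q x) = sommerfeld 0 (p y) (q y) := by
    intro x hx y hy
    refine isOpen_Ioo.is_const_of_deriv_eq_zero isPreconnected_Ioo
      (fun y hy => (hd y hy).differentiableAt.differentiableWithinAt)
      (fun y hy => (hd y hy).deriv) hx hy
  have harg : z.arg ∈ Set.Ioo (-(π / 2)) (π / 2) := by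
    have := Complex.abs_arg_lt_pi_div_two_iff.2 (Or.inl hz)
    exact abs_lt.1 this
  have h := hconst z.arg harg 0 ⟨by linarith [Real.pi_pos], by linarith [Real.pi_pos]⟩
  have hz1 : (r : ℂ) * Complex.exp (z.arg * Complex.I) = z := Complex.norm_mul_exp_arg_mul_I z
  have hz2 : (r : ℂ) * Complex.exp (-(z.arg * Complex.I)) = (starRingEnd ℂ) z := by
    conv_rhs => rw [← hz1]
    rw [map_mul, ← Complex.exp_conj]; simp
  have e1 : p z.arg = z / 2 := by simp only [hpdef]; linear_combination hz1 / 2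
  have e2 : q z.arg = (starRingEnd ℂ) z / 2 := by simp only [hqdef]; linear_combination hz2 / 2
  have e3 : p 0 = r / 2 := by simp [hpdef]
  have e4 : q 0 = r / 2 := by simp [hqdef]
  rw [e1, e2, e3, e4, ← hankel2_eq_sommerfeld 0 hn] at h
  exact h

/-! ### Symmetry, derivatives and recurrences of the Bessel functions -/

theorem re_hankel2 (n : ℤ) (x : ℝ) : (hankel2 n x).re = besselJ n x := by
  simp [hankel2]

theorem continuous_besselJ (n : ℤ) : Continuous (besselJ n) := by
  unfold besselJ
  refine continuous_const.mul
    (intervalIntegral.continuous_parametric_intervalIntegral_of_continuous' ?_ 0 π)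
  fun_prop

theorem besselJ_neg (n : ℤ) (x : ℝ) : besselJ (-n) x = (-1) ^ n * besselJ n x := by
  have h := intervalIntegral.integral_comp_sub_left (a := 0) (b := π)
    (fun θ => Real.cos (((-n : ℤ) : ℝ) * θ - x * Real.sin θ)) π
  rw [sub_self, sub_zero] at h
  rw [besselJ, besselJ, ← h, mul_left_comm,
    ← intervalIntegral.integral_const_mul ((-1 : ℝ) ^ n)]
  refine congrArg (1 / π * ·) (intervalIntegral.integral_congr fun θ _ => ?_)
  rw [Real.sin_pi_sub, ← Real.cos_int_mul_pi_sub, ← Real.cos_neg]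
  congr 1; push_cast; ring

theorem besselY_neg (n : ℤ) (x : ℝ) : besselY (-n) x = (-1) ^ n * besselY n x := by
  have h := intervalIntegral.integral_comp_sub_left (a := 0) (b := π)
    (fun θ => Real.sin (x * Real.sin θ - ((-n : ℤ) : ℝ) * θ)) π
  rw [sub_self, sub_zero] at h
  have hs : ((-1 : ℝ) ^ n) * (-1) ^ n = 1 := by
    rw [← mul_zpow]; norm_num
  rw [besselY, besselY, ← h, mul_sub, mul_left_comm,
    ← intervalIntegral.integral_const_mul ((-1 : ℝ) ^ n), mul_left_comm _ (1 / π),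
    ← integral_const_mul ((-1 : ℝ) ^ n)]
  refine congrArg₂ (1 / π * · - 1 / π * ·) (intervalIntegral.integral_congr fun θ _ => ?_)
    (integral_congr_ae (Eventually.of_forall fun t => ?_))
  · rw [Real.sin_pi_sub, show x * Real.sin θ - ((-n : ℤ) : ℝ) * (π - θ)
      = n * π - (n * θ - x * Real.sin θ) by push_cast; ring, Real.sin_int_mul_pi_sub,
      ← mul_neg, ← Real.sin_neg, neg_sub]
  · push_cast
    rw [zpow_neg, inv_eq_of_mul_eq_one_left hs, neg_mul, neg_neg]
    linear_combination (-Real.exp (-(n * t)) * Real.exp (-(x * Real.sinh t))) * hs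

theorem hankel2_neg (n : ℤ) (x : ℝ) : hankel2 (-n) x = (-1) ^ n * hankel2 n x := by
  rw [hankel2, hankel2, besselJ_neg, besselY_neg]; push_cast; ring

theorem besselJ'_neg (n : ℤ) (x : ℝ) : besselJ' (-n) x = (-1) ^ n * besselJ' n x := by
  rw [besselJ', besselJ', funext (besselJ_neg n), deriv_const_mul_field]

theorem hankel2'_neg (n : ℤ) (x : ℝ) : hankel2' (-n) x = (-1) ^ n * hankel2' n x := by
  rw [hankel2', hankel2', funext (hankel2_neg n), deriv_const_mul_field]

theorem hasDerivAt_besselJ (n : ℤ) {x : ℝ} (hx : 0 < x) :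
    HasDerivAt (besselJ n) ((besselJ (n - 1) x - besselJ (n + 1) x) / 2) x := by
  have h := Complex.reCLM.hasFDerivAt.comp_hasDerivAt x (hasDerivAt_hankel2 n hx)
  have e : besselJ n = Complex.reCLM ∘ hankel2 n := by
    ext y; simp [re_hankel2]
  rw [e]
  refine h.congr_deriv ?_
  rw [Complex.reCLM_apply, ← re_hankel2, ← re_hankel2, ← Complex.sub_re]
  rw [show (2 : ℂ) = ((2 : ℝ) : ℂ) by norm_num, Complex.div_ofReal_re]

theorem besselJ_recurrence (n : ℤ) {x : ℝ} (hx : 0 < x) :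
    besselJ (n - 1) x + besselJ (n + 1) x = 2 * n / x * besselJ n x := by
  have h := congrArg Complex.re (hankel2_recurrence n hx)
  rw [show (2 * n / x : ℂ) = ((2 * n / x : ℝ) : ℂ) by push_cast; rfl, Complex.re_ofReal_mul,
    Complex.add_re] at h
  simpa only [re_hankel2] using h

theorem besselJ'_eq (n : ℤ) {x : ℝ} (hx : 0 < x) :
    besselJ' n x = (besselJ (n - 1) x - besselJ (n + 1) x) / 2 := (hasDerivAt_besselJ n hx).deriv

theorem hankel2'_eq (n : ℤ) {x : ℝ} (hx : 0 < x) :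
    hankel2' n x = (hankel2 (n - 1) x - hankel2 (n + 1) x) / 2 := (hasDerivAt_hankel2 n hx).deriv

theorem besselJ'_eq_sub (n : ℤ) {x : ℝ} (hx : 0 < x) :
    besselJ' n x = besselJ (n - 1) x - n / x * besselJ n x := by
  have h := besselJ_recurrence n hx
  rw [besselJ'_eq n hx]
  linear_combination -h / 2

theorem hankel2'_eq_sub (n : ℤ) {x : ℝ} (hx : 0 < x) :
    hankel2' n x = hankel2 (n - 1) x - n / x * hankel2 n x := by
  have h := hankel2_recurrence n hx
  rw [hankel2'_eq n hx]
  linear_combination -h / 2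

/-! ### Large orders -/

theorem besselJ_zero_right (n : ℤ) : besselJ n 0 = if n = 0 then 1 else 0 := by
  rw [besselJ]
  split_ifs with h
  · subst h; simp [Real.pi_ne_zero]
  · have hn : (n : ℝ) ≠ 0 := by exact_mod_cast h
    have : ∫ θ in (0 : ℝ)..π, Real.cos (n * θ - 0 * Real.sin θ) = 0 := by
      simp only [zero_mul, sub_zero]
      rw [intervalIntegral.integral_comp_mul_left (fun y => Real.cos y) hn]
      simp
    rw [this, mul_zero]

/-- The leading term of `J_n` with the error bound of the alternating power series; it follows by
induction from `(xⁿ J_n)' = xⁿ J_{n-1}`, which reproduces the bound exactly. -/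
theorem abs_besselJ_sub_le (n : ℕ) {x : ℝ} (hx : 0 ≤ x) :
    |besselJ n x - (x / 2) ^ n / n.factorial| ≤ (x / 2) ^ (n + 2) / (n + 1).factorial := by
  induction n generalizing x with
  | zero =>
    have h : ‖∫ θ in (0 : ℝ)..π, (Real.cos (-(x * Real.sin θ)) - 1)‖
        ≤ ∫ θ in (0 : ℝ)..π, x ^ 2 / 2 * Real.sin θ ^ 2 := by
      refine intervalIntegral.norm_integral_le_of_norm_le Real.pi_pos.le
        (Eventually.of_forall fun θ _ => ?_) (Continuous.intervalIntegrable (by fun_prop) _ _)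
      have h1 := Real.one_sub_sq_div_two_le_cos (x := -(x * Real.sin θ))
      have h2 := Real.cos_le_one (-(x * Real.sin θ))
      rw [Real.norm_eq_abs, abs_le]
      constructor <;> nlinarith
    rw [intervalIntegral.integral_sub (Continuous.intervalIntegrable (by fun_prop) _ _)
      intervalIntegrable_const, intervalIntegral.integral_const_mul, integral_sin_sq] at h
    simp only [intervalIntegral.integral_const, Real.sin_zero, Real.cos_zero, Real.sin_pi, sub_zero,
      smul_eq_mul, mul_one, zero_mul, zero_add] at h
    have e : besselJ (0 : ℕ) x - (x / 2) ^ 0 / (Nat.factorial 0 : ℝ)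
        = (1 / π) * ((∫ θ in (0 : ℝ)..π, Real.cos (-(x * Real.sin θ))) - π) := by
      have := Real.pi_ne_zero
      rw [besselJ]; simp; field_simp
    rw [e, abs_mul, abs_of_pos (by positivity : (0 : ℝ) < 1 / π), one_div,
      inv_mul_le_iff₀ Real.pi_pos, ← Real.norm_eq_abs]
    refine h.trans (le_of_eq ?_)
    simp [Nat.factorial]; ring
  | succ n ih =>
    rcases hx.eq_or_lt with rfl | hx0
    · have h0 : ((n : ℤ) + 1) ≠ 0 := by positivity
      simp [besselJ_zero_right, h0]
    set D : ℝ → ℝ := fun s => s ^ (n + 1) * besselJ ((n + 1 : ℕ) : ℤ) s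
      - s ^ (n + 1) * ((s / 2) ^ (n + 1) / (n + 1).factorial) with hD
    set B : ℝ → ℝ := fun s => s ^ (n + 1) * ((s / 2) ^ (n + 1 + 2) / (n + 1 + 1).factorial) with hB
    have hcD : Continuous D := by
      have := continuous_besselJ ((n + 1 : ℕ) : ℤ)
      simp only [hD]; fun_prop
    have hcB : Continuous B := by simp only [hB]; fun_prop
    have hf1 : ((n + 1).factorial : ℝ) = (n + 1) * n.factorial := by
      rw [Nat.factorial_succ]; push_cast; ring
    have hf2 : ((n + 1 + 1).factorial : ℝ) = (n + 2) * ((n + 1) * n.factorial) := by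
      rw [Nat.factorial_succ, Nat.cast_mul, hf1]; push_cast; ring
    have hf0 : (n.factorial : ℝ) ≠ 0 := by positivity
    have hdD : ∀ s, 0 < s → HasDerivAt D
        (s ^ (n + 1) * (besselJ n s - (s / 2) ^ n / n.factorial)) s := by
      intro s hs
      have h1 := hasDerivAt_besselJ ((n + 1 : ℕ) : ℤ) hs
      have h2 := besselJ_recurrence ((n + 1 : ℕ) : ℤ) hs
      have e1 : (((n + 1 : ℕ) : ℤ) - 1) = n := by push_cast; ring
      rw [e1] at h1 h2
      have h3 := ((hasDerivAt_pow (n + 1) s).mul h1).sub ((hasDerivAt_pow (n + 1) s).mul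
        ((((hasDerivAt_id s).div_const 2).pow (n + 1)).div_const ((n + 1).factorial : ℝ)))
      refine HasDerivAt.congr_deriv h3 ?_
      have h4 : besselJ (((n + 1 : ℕ) : ℤ) + 1) s
        = 2 * ((n + 1 : ℕ) : ℤ) / s * besselJ ((n + 1 : ℕ) : ℤ) s - besselJ n s := by
        linarith
      rw [h4, hf1]
      simp only [Nat.add_sub_cancel, id, Pi.pow_apply]
      simp only [pow_succ, div_pow]
      push_cast
      field_simp
      ring
    have hdB : ∀ s, HasDerivAt B
        (s ^ (n + 1) * ((s / 2) ^ (n + 2) / (n + 1).factorial)) s := by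
      intro s
      have h3 := ((hasDerivAt_pow (n + 1) s).mul
        ((((hasDerivAt_id s).div_const 2).pow (n + 1 + 2)).div_const ((n + 1 + 1).factorial : ℝ)))
      refine HasDerivAt.congr_deriv h3 ?_
      rw [hf2, hf1]
      simp only [Nat.add_sub_cancel, id, Pi.pow_apply, show n + 1 + 2 - 1 = n + 2 by omega]
      simp only [pow_succ, div_pow]
      push_cast
      field_simp
      ring
    -- both signs of the bound at once
    have hle : ∀ ε : ℝ, |ε| = 1 → 0 ≤ B x + ε * D x := by
      intro ε hε
      have hd : ∀ s, 0 < s → HasDerivAt (fun s => B s + ε * D s)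
          (s ^ (n + 1) * ((s / 2) ^ (n + 2) / (n + 1).factorial)
          + ε * (s ^ (n + 1) * (besselJ n s - (s / 2) ^ n / n.factorial))) s := fun s hs =>
        (hdB s).add ((hdD s hs).const_mul ε)
      have hm : MonotoneOn (fun s => B s + ε * D s) (Set.Icc 0 x) := by
        refine monotoneOn_of_deriv_nonneg (convex_Icc 0 x) (by fun_prop) ?_ ?_
        · rw [interior_Icc]
          exact fun s hs => (hd s hs.1).differentiableAt.differentiableWithinAt
        · rw [interior_Icc]
          intro s hs
          rw [(hd s hs.1).deriv]
          have h1 := ih hs.1.le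
          have h2 : |ε * (besselJ n s - (s / 2) ^ n / n.factorial)|
              ≤ (s / 2) ^ (n + 2) / (n + 1).factorial := by rwa [abs_mul, hε, one_mul]
          have h3 := (abs_le.1 h2).1
          have h4 : 0 ≤ s ^ (n + 1) := pow_nonneg hs.1.le _
          nlinarith
      have := hm ⟨le_rfl, hx⟩ ⟨hx, le_rfl⟩ hx
      simpa [hB, hD] using this
    have h1 := hle 1 (by simp)
    have h2 := hle (-1) (by simp)
    have hxp : 0 < x ^ (n + 1) := by positivity
    have hDx : |D x| ≤ B x := abs_le.2 ⟨by linarith, by linarith⟩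
    simp only [hD, hB, ← mul_sub, abs_mul, abs_of_pos hxp] at hDx
    exact le_of_mul_le_mul_left hDx hxp

theorem tendsto_besselJ_nat {x : ℝ} (hx : 0 < x) :
    Tendsto (fun n : ℕ => besselJ n x * n.factorial / (x / 2) ^ n) atTop (𝓝 1) := by
  have h0 : Tendsto (fun n : ℕ => (x / 2) ^ 2 * (1 / ((n : ℝ) + 1))) atTop (𝓝 0) := by
    simpa using (tendsto_one_div_add_atTop_nhds_zero_nat (𝕜 := ℝ)).const_mul ((x / 2) ^ 2)
  rw [tendsto_iff_norm_sub_tendsto_zero]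
  refine squeeze_zero (fun _ => norm_nonneg _) (fun n => ?_) h0
  have h := abs_besselJ_sub_le n hx.le
  have hp : 0 < (n.factorial : ℝ) / (x / 2) ^ n := by positivity
  have e : besselJ n x * n.factorial / (x / 2) ^ n - 1
      = (besselJ n x - (x / 2) ^ n / n.factorial) * (n.factorial / (x / 2) ^ n) := by
    field_simp
  rw [e, norm_mul, Real.norm_eq_abs, Real.norm_eq_abs, abs_of_pos hp]
  refine (mul_le_mul_of_nonneg_right h hp.le).trans (le_of_eq ?_)
  rw [Nat.factorial_succ, pow_add]
  push_cast
  field_simp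

theorem tendsto_besselJ_succ {x : ℝ} (hx : 0 < x) :
    Tendsto (fun n : ℕ => besselJ (n + 1) x * (n + 1).factorial / (x / 2) ^ (n + 1)) atTop
      (𝓝 1) := by
  simpa using (tendsto_add_atTop_iff_nat 1).2 (tendsto_besselJ_nat hx)

theorem tendsto_besselJ'_succ {x : ℝ} (hx : 0 < x) :
    Tendsto (fun n : ℕ => besselJ' (n + 1) x * n.factorial / (x / 2) ^ (n + 1)) atTop
      (𝓝 (1 / x)) := by
  have h := ((tendsto_besselJ_nat hx).mul_const (2 / x)).sub
    ((tendsto_besselJ_succ hx).mul_const (1 / x))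
  rw [show 1 * (2 / x) - 1 * (1 / x) = 1 / x by ring] at h
  refine h.congr fun n => ?_
  rw [besselJ'_eq_sub _ hx, Nat.factorial_succ, pow_succ]
  push_cast
  rw [add_sub_cancel_right]
  field_simp

theorem contourIntegrand_ofReal_zero (n : ℤ) (p t : ℝ) :
    contourIntegrand n p 0 t = ((Real.exp (n * t - p * Real.exp t) : ℝ) : ℂ) := by
  rw [contourIntegrand]; push_cast; congr 1; ring

/-- For `q = 0` the recurrence of the half-line integral is solved by partial sums of the
exponential series. -/
theorem tailIntegral_zero_right (n : ℕ) {p : ℝ} (hp : 0 < p) :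
    tailIntegral (n + 1) p 0 * p ^ (n + 1) / n.factorial
      = Complex.exp (-p) * ∑ k ∈ Finset.range (n + 1), (p : ℂ) ^ k / k.factorial := by
  have hp' : (p : ℂ) ≠ 0 := by exact_mod_cast hp.ne'
  induction n with
  | zero =>
    have h := tailIntegral_recurrence 0 (p := p) 0 (by simpa using hp)
    simp only [Int.cast_zero, zero_mul, zero_sub, sub_zero, zero_add, neg_inj] at h
    simp [← h, mul_comm]
  | succ n ih =>
    have h := tailIntegral_recurrence ((n : ℤ) + 1) (p := p) 0 (by simpa using hp)
    rw [zero_mul, sub_zero, zero_sub] at h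
    rw [Finset.sum_range_succ, mul_add, ← ih, Nat.factorial_succ]
    have hf : (n.factorial : ℂ) ≠ 0 := by exact_mod_cast n.factorial_ne_zero
    have hn : (n : ℂ) + 1 ≠ 0 := by exact_mod_cast n.succ_ne_zero
    push_cast at h ⊢
    field_simp
    linear_combination (-(p : ℂ) ^ (n + 1)) * h

theorem tendsto_tailIntegral_zero_right {p : ℝ} (hp : 0 < p) :
    Tendsto (fun n : ℕ => tailIntegral (n + 1) p 0 * p ^ (n + 1) / n.factorial) atTop (𝓝 1) := by
  simp only [tailIntegral_zero_right _ hp]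
  have h := (NormedSpace.expSeries_div_hasSum_exp (p : ℂ)).tendsto_sum_nat
  rw [← Complex.exp_eq_exp_ℂ] at h
  have h2 := ((tendsto_add_atTop_iff_nat 1).2 h).const_mul (Complex.exp (-p))
  rwa [← Complex.exp_add, neg_add_cancel, Complex.exp_zero] at h2

/-- Replacing `q` by `0` changes the half-line integral only by a multiple of the integral of lower
order, since `0 ≤ exp (q e^{-t}) - 1 ≤ q e^q e^{-t}`. -/
theorem norm_tailIntegral_sub_le (n : ℤ) {p q : ℝ} (hp : 0 < p) (hq : 0 ≤ q) :
    ‖tailIntegral n p q - tailIntegral n p 0‖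
      ≤ q * Real.exp q * ‖tailIntegral (n - 1) p 0‖ := by
  have hre : 0 < (p : ℂ).re := by simpa using hp
  have e : ‖tailIntegral (n - 1) p 0‖
      = ∫ t in Set.Ioi (0 : ℝ), Real.exp ((n - 1 : ℤ) * t - p * Real.exp t) := by
    rw [tailIntegral]
    simp only [contourIntegrand_ofReal_zero]
    rw [integral_complex_ofReal]
    refine (Complex.norm_real _).trans (abs_of_nonneg ?_)
    exact integral_nonneg fun t => (Real.exp_pos _).le
  rw [e, tailIntegral, tailIntegral, ← integral_sub (integrableOn_contourIntegrand n _ hre)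
    (integrableOn_contourIntegrand n _ hre), ← integral_const_mul]
  refine norm_integral_le_of_norm_le ((integrableOn_exp_sub_mul_exp _ hp).const_mul _) ?_
  refine (ae_restrict_mem measurableSet_Ioi).mono fun t ht => ?_
  have ht' : Real.exp (-t) ≤ 1 := Real.exp_le_one_iff.2 (by linarith [Set.mem_Ioi.1 ht])
  have e1 : contourIntegrand n p q t - contourIntegrand n p 0 t
      = ((Real.exp (n * t - p * Real.exp t) * (Real.exp (q * Real.exp (-t)) - 1) : ℝ) : ℂ) := by
    rw [contourIntegrand_ofReal_zero, contourIntegrand]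
    push_cast
    rw [Complex.exp_add]; ring
  set y := q * Real.exp (-t) with hy
  have hy0 : 0 ≤ y := by positivity
  have hyq : y ≤ q := by nlinarith [Real.exp_pos (-t)]
  have h1 : Real.exp y - 1 ≤ y * Real.exp q := by
    have h2 := Real.add_one_le_exp (-y)
    have h3 : Real.exp y * Real.exp (-y) = 1 := by rw [← Real.exp_add]; simp
    have h4 : Real.exp y ≤ Real.exp q := Real.exp_le_exp.2 hyq
    nlinarith [Real.exp_pos y]
  have h0 : 0 ≤ Real.exp y - 1 := by linarith [Real.add_one_le_exp y]
  rw [e1, Complex.norm_real, Real.norm_eq_abs, abs_of_nonneg (by positivity)]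
  have e2 : q * Real.exp q * Real.exp ((n - 1 : ℤ) * t - p * Real.exp t)
      = Real.exp (n * t - p * Real.exp t) * (y * Real.exp q) := by
    rw [hy, show ((n - 1 : ℤ) : ℝ) * t - p * Real.exp t = (n * t - p * Real.exp t) + -t by
      push_cast; ring, Real.exp_add]
    ring
  rw [e2]
  gcongr

theorem tendsto_pow_div_factorial (p : ℝ) :
    Tendsto (fun n : ℕ => p ^ (n + 1) / n.factorial) atTop (𝓝 0) := by
  have := (FloorSemiring.tendsto_pow_div_factorial_atTop p).mul_const p
  rw [zero_mul] at this
  exact this.congr fun n => by rw [pow_succ]; ring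

theorem tendsto_tailIntegral {p : ℝ} (hp : 0 < p) :
    Tendsto (fun n : ℕ => tailIntegral (n + 1) p p * p ^ (n + 1) / n.factorial) atTop (𝓝 1) := by
  have h1 := tendsto_tailIntegral_zero_right hp
  have h2 : Tendsto (fun n : ℕ => (tailIntegral (n + 1) p p - tailIntegral (n + 1) p 0)
      * p ^ (n + 1) / n.factorial) atTop (𝓝 0) := by
    rw [← tendsto_add_atTop_iff_nat 1]
    have h3 : Tendsto (fun n : ℕ => p * Real.exp p * p * (1 / ((n : ℝ) + 1))
        * ‖tailIntegral (n + 1) p 0 * p ^ (n + 1) / n.factorial‖) atTop (𝓝 0) := by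
      have := ((tendsto_one_div_add_atTop_nhds_zero_nat (𝕜 := ℝ)).const_mul
        (p * Real.exp p * p)).mul h1.norm
      simpa using this
    refine squeeze_zero_norm (fun n => ?_) h3
    have h4 := norm_tailIntegral_sub_le ((n : ℤ) + 1 + 1) hp hp.le
    rw [add_sub_cancel_right] at h4
    rw [norm_div, norm_mul, norm_div, norm_mul]
    simp only [norm_pow, Complex.norm_natCast, Complex.norm_real, Real.norm_eq_abs, abs_of_pos hp]
    rw [Nat.factorial_succ]
    simp only [Nat.cast_mul, Nat.cast_add, Nat.cast_one]
    calc _ ≤ p * Real.exp p * ‖tailIntegral ((n : ℤ) + 1) p 0‖ * p ^ (n + 1 + 1)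
          / ((n + 1) * n.factorial) := by gcongr
      _ = _ := by field_simp; ring
  have := h1.add h2
  rw [add_zero] at this
  exact this.congr fun n => by ring

theorem norm_tailIntegral_neg_le (n : ℕ) {p : ℝ} (hp : 0 < p) :
    ‖tailIntegral (-n) p p‖
      ≤ ∫ t in Set.Ioi (0 : ℝ), Real.exp p * Real.exp ((0 : ℝ) * t - p * Real.exp t) := by
  refine norm_integral_le_of_norm_le ((integrableOn_exp_sub_mul_exp _ hp).const_mul _) ?_
  refine (ae_restrict_mem measurableSet_Ioi).mono fun t ht => ?_
  have ht' : 0 < t := ht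
  refine (norm_contourIntegrand_le (c := p) (M := p) (-n) (by simp) (by simp [abs_of_pos hp])
    ht'.le).trans ?_
  gcongr
  push_cast
  have : (0 : ℝ) ≤ n * t := by positivity
  linarith

theorem norm_arcIntegral_le (n : ℤ) (x : ℝ) : ‖arcIntegral n (x / 2) (x / 2)‖ ≤ π := by
  have h : ‖arcIntegral n (x / 2) (x / 2)‖ ≤ 1 * |π - 0| := by
    refine intervalIntegral.norm_integral_le_of_norm_le_const fun s _ => ?_
    rw [contourIntegrand_half_arc, show x * Real.sin s - n * s = -(n * s - x * Real.sin s) by ring,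
      Real.sin_neg, Complex.ofReal_neg, mul_neg, sub_neg_eq_add, mul_comm Complex.I,
      Complex.ofReal_cos, Complex.ofReal_sin, ← Complex.exp_mul_I, Complex.norm_exp_ofReal_mul_I]
  rwa [sub_zero, abs_of_pos Real.pi_pos, one_mul] at h

theorem tendsto_hankel2_succ {x : ℝ} (hx : 0 < x) :
    Tendsto (fun n : ℕ => hankel2 (n + 1) x * (x / 2) ^ (n + 1) / n.factorial) atTop
      (𝓝 (Complex.I / π)) := by
  have hp : 0 < x / 2 := by positivity
  have e : ((x / 2 : ℝ) : ℂ) = (x : ℂ) / 2 := by push_cast; rfl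
  have h1 := tendsto_tailIntegral hp
  have h2 : Tendsto (fun n : ℕ => arcIntegral (n + 1) (x / 2) (x / 2) * (x / 2) ^ (n + 1)
      / n.factorial) atTop (𝓝 0) := by
    have h3 := (tendsto_pow_div_factorial (x / 2)).const_mul π
    rw [mul_zero] at h3
    refine squeeze_zero_norm (fun n => ?_) h3
    rw [norm_div, norm_mul, norm_pow, ← e, Complex.norm_real, Real.norm_eq_abs, abs_of_pos hp,
      Complex.norm_natCast, mul_div_assoc, e]
    gcongr
    exact norm_arcIntegral_le _ _
  have h4 : Tendsto (fun n : ℕ => (-1 : ℂ) ^ ((n : ℤ) + 1) * tailIntegral (-((n : ℤ) + 1)) (x / 2)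
      (x / 2) * (x / 2) ^ (n + 1) / n.factorial) atTop (𝓝 0) := by
    have h3 := (tendsto_pow_div_factorial (x / 2)).const_mul
      (∫ t in Set.Ioi (0 : ℝ), Real.exp (x / 2) * Real.exp ((0 : ℝ) * t - x / 2 * Real.exp t))
    rw [mul_zero] at h3
    refine squeeze_zero_norm (fun n => ?_) h3
    rw [norm_div, norm_mul, norm_mul, norm_pow, ← e, Complex.norm_real, Real.norm_eq_abs,
      abs_of_pos hp, Complex.norm_natCast, mul_div_assoc, norm_zpow, norm_neg, norm_one, one_zpow,
      one_mul]
    gcongr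
    exact_mod_cast norm_tailIntegral_neg_le (n + 1) hp
  have h5 := (((h2.add (h1.const_mul Complex.I)).add (h4.const_mul Complex.I)).const_mul
    (1 / π : ℂ))
  rw [show (1 / π : ℂ) * (0 + Complex.I * 1 + Complex.I * 0) = Complex.I / π by ring] at h5
  refine h5.congr fun n => ?_
  rw [hankel2_eq_sommerfeld _ hx, sommerfeld, e]
  ring

theorem tendsto_hankel2'_succ {x : ℝ} (hx : 0 < x) :
    Tendsto (fun n : ℕ => hankel2' (n + 1) x * (x / 2) ^ (n + 1) / (n + 1).factorial) atTop
      (𝓝 (-(Complex.I / π) / x)) := by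
  have hx' : (x : ℂ) ≠ 0 := by exact_mod_cast hx.ne'
  rw [← tendsto_add_atTop_iff_nat 1]
  have h1 := tendsto_hankel2_succ hx
  have h2 := (tendsto_add_atTop_iff_nat 1).2 h1
  have h3 : Tendsto (fun n : ℕ => (1 / (((n : ℝ) + 1 : ℝ) : ℂ))) atTop (𝓝 0) := by
    have := (Complex.continuous_ofReal.tendsto 0).comp
      (tendsto_one_div_add_atTop_nhds_zero_nat (𝕜 := ℝ))
    rw [Complex.ofReal_zero] at this
    refine this.congr fun n => ?_
    simp
  have h4 := (h3.comp (tendsto_add_atTop_nat 1)).mul h3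
  have h5 := ((h4.mul h1).mul_const ((x : ℂ) / 2)).sub (h2.mul_const (1 / (x : ℂ)))
  rw [show (0 : ℂ) * 0 * (Complex.I / π) * (x / 2) - Complex.I / π * (1 / x)
    = -(Complex.I / π) / x by ring] at h5
  refine h5.congr fun n => ?_
  have hf : (n.factorial : ℂ) ≠ 0 := by exact_mod_cast n.factorial_ne_zero
  have hn : (n : ℂ) + 1 ≠ 0 := by exact_mod_cast n.succ_ne_zero
  have hn' : (n : ℂ) + 1 + 1 ≠ 0 := by exact_mod_cast (n + 1).succ_ne_zero
  rw [hankel2'_eq_sub _ hx]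
  simp only [Function.comp, Nat.factorial_succ, pow_succ]
  push_cast
  rw [add_sub_cancel_right]
  field_simp

/-! ### The Wronskian -/

/-- The cross product `J_{n+1} H_n - J_n H_{n+1}` does not depend on `n`, by the recurrences, so
that it is determined by the behaviour of its factors for large orders. -/
theorem besselJ_mul_hankel2_cross (n : ℤ) {x : ℝ} (hx : 0 < x) :
    besselJ (n + 1) x * hankel2 n x - besselJ n x * hankel2 (n + 1) x
      = -(2 * Complex.I / (π * x)) := by
  set W : ℤ → ℂ := fun n => besselJ (n + 1) x * hankel2 n x - besselJ n x * hankel2 (n + 1) x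
    with hW
  have hx' : (x : ℂ) ≠ 0 := by exact_mod_cast hx.ne'
  have hstep : ∀ n, W (n + 1) = W n := by
    intro n
    have h1 := hankel2_recurrence (n + 1) hx
    have h2 : ((besselJ (n + 1 - 1) x + besselJ (n + 1 + 1) x : ℝ) : ℂ)
      = ((2 * (n + 1 : ℤ) / x * besselJ (n + 1) x : ℝ) : ℂ) := by rw [besselJ_recurrence _ hx]
    rw [add_sub_cancel_right] at h1 h2
    push_cast at h1 h2
    simp only [hW]
    linear_combination hankel2 (n + 1) x * h2 - besselJ (n + 1) x * h1
  have hconst : ∀ n, W n = W 0 := by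
    intro n
    induction n using Int.induction_on with
    | zero => rfl
    | succ k ih => rw [hstep, ih]
    | pred k ih => rw [← ih, ← hstep]; congr 1; ring
  have hJ : Tendsto (fun n : ℕ => ((besselJ (n + 1) x * (n + 1).factorial / (x / 2) ^ (n + 1) : ℝ)
      : ℂ)) atTop (𝓝 1) := by
    have := (Complex.continuous_ofReal.tendsto 1).comp (tendsto_besselJ_succ hx)
    rw [Complex.ofReal_one] at this
    exact this
  have hH := tendsto_hankel2_succ hx
  have h3 : Tendsto (fun n : ℕ => (1 / (((n : ℝ) + 1 : ℝ) : ℂ))) atTop (𝓝 0) := by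
    have := (Complex.continuous_ofReal.tendsto 0).comp
      (tendsto_one_div_add_atTop_nhds_zero_nat (𝕜 := ℝ))
    rw [Complex.ofReal_zero] at this
    refine this.congr fun n => ?_
    simp
  have h4 := (h3.comp (tendsto_add_atTop_nat 1)).mul h3
  have h5 := ((((hJ.comp (tendsto_add_atTop_nat 1)).mul hH).mul h4).mul_const ((x : ℂ) / 2)).sub
    ((hJ.mul (hH.comp (tendsto_add_atTop_nat 1))).mul_const (2 / (x : ℂ)))
  have h6 : Tendsto (fun _ : ℕ => W 0) atTop
      (𝓝 (1 * (Complex.I / π) * (0 * 0) * (x / 2) - 1 * (Complex.I / π) * (2 / x))) := by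
    refine h5.congr fun n => ?_
    rw [← hconst (n + 1)]
    have hf : (n.factorial : ℂ) ≠ 0 := by exact_mod_cast n.factorial_ne_zero
    have hn : (n : ℂ) + 1 ≠ 0 := by exact_mod_cast n.succ_ne_zero
    have hn' : (n : ℂ) + 1 + 1 ≠ 0 := by exact_mod_cast (n + 1).succ_ne_zero
    have hp : ((x : ℂ) / 2) ^ n ≠ 0 := pow_ne_zero _ (div_ne_zero hx' two_ne_zero)
    simp only [hW, Function.comp, Nat.factorial_succ, pow_succ]
    push_cast
    field_simp
  have h7 := tendsto_nhds_unique tendsto_const_nhds h6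
  have h8 := hconst n
  rw [h7] at h8
  simp only [hW] at h8
  rw [h8]
  have := Complex.ofReal_ne_zero.2 Real.pi_ne_zero
  field_simp
  ring

theorem besselJ_hankel2_wronskian (n : ℤ) {x : ℝ} (hx : 0 < x) :
    besselJ n x * hankel2' n x - besselJ' n x * hankel2 n x = -(2 * Complex.I / (π * x)) := by
  have h := besselJ_mul_hankel2_cross (n - 1) hx
  rw [sub_add_cancel] at h
  rw [← h, besselJ'_eq_sub n hx, hankel2'_eq_sub n hx]
  push_cast
  ring

/-- The Wronskian does not vanish. -/
theorem two_I_div_ne_zero {x : ℝ} (hx : 0 < x) : -(2 * Complex.I / (π * x)) ≠ 0 := by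
  have h1 : (x : ℂ) ≠ 0 := by exact_mod_cast hx.ne'
  have h2 : (π : ℂ) ≠ 0 := by exact_mod_cast Real.pi_ne_zero
  simp [h1, h2]

theorem hankel2_ne_zero (n : ℤ) {x : ℝ} (hx : 0 < x) : hankel2 n x ≠ 0 := by
  intro h
  have hJ : besselJ n x = 0 := by rw [← re_hankel2, h, Complex.zero_re]
  have hW := besselJ_hankel2_wronskian n hx
  rw [h, hJ] at hW
  exact two_I_div_ne_zero hx (by rw [← hW]; simp)

theorem besselJ_ne_zero_or (n : ℤ) {x : ℝ} (hx : 0 < x) : besselJ n x ≠ 0 ∨ besselJ' n x ≠ 0 := by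
  by_contra! h
  have hW := besselJ_hankel2_wronskian n hx
  rw [h.1, h.2] at hW
  exact two_I_div_ne_zero hx (by rw [← hW]; simp)

/-! ### Fourier coefficients of integrable functions -/

/-- The unnormalised `n`-th Fourier coefficient `∫ f(x) e^{-inx} dx` over `(-π, π)`. -/
noncomputable def fourierInt (f : ℝ → ℂ) (n : ℤ) : ℂ :=
  ∫ x in (-π)..π, f x * Complex.exp (-(Complex.I * n * x))

theorem fourierCoeffOn_eq_fourierInt (f : ℝ → ℂ) (n : ℤ) :
    fourierCoeffOn (neg_lt_self Real.pi_pos) f n = fourierInt f n / (2 * π) := by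
  rw [fourierCoeffOn_eq_integral, fourierInt, show (1 : ℝ) / (π - -π) = (2 * π)⁻¹ by
    rw [one_div]; ring_nf, Complex.real_smul, mul_comm, div_eq_mul_inv]
  push_cast
  congr 1
  refine intervalIntegral.integral_congr fun x _ => ?_
  have hpi : (π : ℂ) ≠ 0 := by exact_mod_cast Real.pi_ne_zero
  simp only [fourier_coe_apply, smul_eq_mul]
  rw [mul_comm]
  congr 2
  push_cast
  field_simp
  ring

theorem norm_exp_neg_I_mul (n : ℤ) (x : ℝ) : ‖Complex.exp (-(Complex.I * n * x))‖ = 1 := by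
  rw [show -(Complex.I * n * x) = Complex.I * ((-(n * x) : ℝ) : ℂ) by push_cast; ring,
    Complex.norm_exp_I_mul_ofReal]

theorem exp_neg_I_mul_periodic (n : ℤ) :
    Function.Periodic (fun x : ℝ => Complex.exp (-(Complex.I * n * x))) (2 * π) := by
  intro x
  simp only
  rw [Complex.exp_eq_exp_iff_exists_int]
  exact ⟨-n, by push_cast; ring⟩

theorem intervalIntegrable_mul_exp {f : ℝ → ℂ} (hf : IntervalIntegrable f volume (-π) π) (n : ℤ) :
    IntervalIntegrable (fun x => f x * Complex.exp (-(Complex.I * n * x))) volume (-π) π :=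
  hf.mul_continuousOn (by fun_prop)

theorem fourierInt_add {f g : ℝ → ℂ} (hf : IntervalIntegrable f volume (-π) π)
    (hg : IntervalIntegrable g volume (-π) π) (n : ℤ) :
    fourierInt (fun x => f x + g x) n = fourierInt f n + fourierInt g n := by
  simp only [fourierInt, add_mul]
  exact intervalIntegral.integral_add (intervalIntegrable_mul_exp hf n)
    (intervalIntegrable_mul_exp hg n)

theorem fourierInt_const_mul (c : ℂ) (f : ℝ → ℂ) (n : ℤ) :
    fourierInt (fun x => c * f x) n = c * fourierInt f n := by
  simp only [fourierInt, mul_assoc]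
  exact intervalIntegral.integral_const_mul _ _

theorem fourierInt_neg (f : ℝ → ℂ) (n : ℤ) :
    fourierInt (fun x => -f x) n = -fourierInt f n := by
  simpa using fourierInt_const_mul (-1) f n

/-- An integrable function whose Fourier coefficients vanish is orthogonal to all continuous
periodic functions, by density of the trigonometric polynomials. -/
theorem integral_mul_eq_zero_of_fourierInt_eq_zero {f : ℝ → ℂ}
    (hf : IntervalIntegrable f volume (-π) π) (h : ∀ n, fourierInt f n = 0)
    (G : C(AddCircle (2 * π), ℂ)) : ∫ x in (-π)..π, f x * G x = 0 := by
  have : Fact (0 < 2 * π) := ⟨Real.two_pi_pos⟩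
  have hint : ∀ G : C(AddCircle (2 * π), ℂ),
      IntervalIntegrable (fun x : ℝ => f x * G x) volume (-π) π := fun G =>
    hf.mul_continuousOn
      (Continuous.continuousOn (G.continuous.comp (AddCircle.continuous_mk' (2 * π))))
  let Λ : C(AddCircle (2 * π), ℂ) →ₗ[ℂ] ℂ :=
    { toFun := fun G => ∫ x in (-π)..π, f x * G x
      map_add' := fun G H => by
        simp only [ContinuousMap.add_apply, mul_add]
        exact intervalIntegral.integral_add (hint G) (hint H)
      map_smul' := fun c G => by
        simp only [ContinuousMap.smul_apply, smul_eq_mul, RingHom.id_apply, mul_left_comm _ c]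
        exact intervalIntegral.integral_const_mul _ _ }
  let Λc : C(AddCircle (2 * π), ℂ) →L[ℂ] ℂ := Λ.mkContinuous (∫ x in (-π)..π, ‖f x‖) fun G => by
    rw [← intervalIntegral.integral_mul_const]
    refine intervalIntegral.norm_integral_le_of_norm_le (by linarith [Real.pi_pos])
      (Eventually.of_forall fun x _ => ?_) (hf.norm.mul_const _)
    rw [norm_mul]
    gcongr
    exact G.norm_coe_le_norm _
  have hspan : Submodule.span ℂ (Set.range (@fourier (2 * π))) ≤ LinearMap.ker Λc.toLinearMap := by
    rw [Submodule.span_le]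
    rintro _ ⟨n, rfl⟩
    have := h (-n)
    rw [fourierInt] at this
    refine Eq.trans (intervalIntegral.integral_congr fun x _ => ?_) this
    simp only [fourier_coe_apply]
    congr 2
    have hpi : (π : ℂ) ≠ 0 := by exact_mod_cast Real.pi_ne_zero
    push_cast
    field_simp
  have hcl := Submodule.topologicalClosure_minimal _ hspan Λc.isClosed_ker
  rw [span_fourier_closure_eq_top] at hcl
  exact hcl (Submodule.mem_top (x := G))

theorem ae_eq_zero_of_fourierInt_eq_zero {f : ℝ → ℂ}
    (hf : IntervalIntegrable f volume (-π) π) (h : ∀ n, fourierInt f n = 0) :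
    ∀ᵐ x ∂(volume.restrict (Set.Ioc (-π) π)), f x = 0 := by
  have : Fact (0 < 2 * π) := ⟨Real.two_pi_pos⟩
  have hle : -π ≤ π := by linarith [Real.pi_pos]
  have hT : -π + 2 * π = π := by ring
  have hIoc : IntegrableOn f (Set.Ioc (-π) π) :=
    (intervalIntegrable_iff_integrableOn_Ioc_of_le hle).1 hf
  rw [← restrict_Ioo_eq_restrict_Ioc, ae_restrict_iff' measurableSet_Ioo]
  refine isOpen_Ioo.ae_eq_zero_of_integral_contDiff_smul_eq_zero
    ((hIoc.mono_set Set.Ioo_subset_Ioc_self).locallyIntegrableOn) fun g hg _ hgs => ?_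
  have hg0 : ∀ x ∉ Set.Ioo (-π) π, g x = 0 := fun x hx =>
    image_eq_zero_of_notMem_tsupport fun hx' => hx (hgs hx')
  have hcont : Continuous (AddCircle.liftIoc (2 * π) (-π) (fun x => (g x : ℂ))) := by
    refine AddCircle.liftIoc_continuous ?_ (Continuous.continuousOn ?_)
    · rw [hT, hg0 (-π) (fun hx => lt_irrefl _ hx.1), hg0 π (fun hx => lt_irrefl _ hx.2)]
    · exact Complex.continuous_ofReal.comp hg.continuous
  have key := integral_mul_eq_zero_of_fourierInt_eq_zero hf h ⟨_, hcont⟩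
  rw [intervalIntegral.integral_of_le hle] at key
  rw [← setIntegral_eq_integral_of_forall_compl_eq_zero (s := Set.Ioc (-π) π)]
  · refine Eq.trans (setIntegral_congr_fun measurableSet_Ioc fun x hx => ?_) key
    have : x ∈ Set.Ioc (-π) (-π + 2 * π) := by rwa [hT]
    simp only [ContinuousMap.coe_mk, AddCircle.liftIoc_coe_apply this]
    rw [Complex.real_smul, mul_comm]
  · intro x hx
    rw [hg0 x fun hx' => hx (Set.Ioo_subset_Ioc_self hx'), zero_smul]

theorem eq_zero_of_fourierInt_eq_zero {F : ℝ → ℂ} (hF : Continuous F)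
    (hp : Function.Periodic F (2 * π)) (h : ∀ n, fourierInt F n = 0) (φ : ℝ) : F φ = 0 := by
  have hae := ae_eq_zero_of_fourierInt_eq_zero (hF.intervalIntegrable _ _) h
  rw [Measure.restrict_congr_set Ioc_ae_eq_Icc] at hae
  have heq := Measure.eqOn_Icc_of_ae_eq volume (by linarith [Real.pi_pos]) (g := fun _ => 0) hae
    hF.continuousOn continuousOn_const
  obtain ⟨y, hy, hyφ⟩ := hp.exists_mem_Ioc Real.two_pi_pos φ (-π)
  rw [hyφ]
  exact heq ⟨hy.1.le, by linarith [hy.2]⟩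

/-- Interchange of an integral over `(-π, π)` with a dominated integral. -/
theorem intervalIntegral_integral_swap {μ : Measure ℝ} [SFinite μ] {f : ℝ → ℝ → ℂ} {g : ℝ → ℝ}
    (hf : AEStronglyMeasurable (Function.uncurry f) ((volume.restrict (Set.Ioc (-π) π)).prod μ))
    (hg : Integrable g μ) (h : ∀ᵐ t ∂μ, ∀ θ, ‖f θ t‖ ≤ g t) :
    ∫ θ in (-π)..π, ∫ t, f θ t ∂μ = ∫ t, (∫ θ in (-π)..π, f θ t) ∂μ := by
  have hle : -π ≤ π := by linarith [Real.pi_pos]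
  simp only [intervalIntegral.integral_of_le hle]
  refine integral_integral_swap (Integrable.mono' (hg.comp_snd _) hf ?_)
  filter_upwards [Measure.quasiMeasurePreserving_snd.ae h] with z hz using hz z.1

/-! ### Convolution with a continuous periodic kernel -/

theorem exists_norm_le_of_periodic {K : ℝ → ℂ} (hK : Continuous K)
    (hp : Function.Periodic K (2 * π)) : ∃ B, 0 ≤ B ∧ ∀ x, ‖K x‖ ≤ B := by
  obtain ⟨B, hB⟩ := (isCompact_Icc (a := (0 : ℝ)) (b := 0 + 2 * π)).exists_bound_of_continuousOn
    hK.continuousOn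
  refine ⟨B, (norm_nonneg _).trans (hB 0 ⟨le_rfl, by simpa using Real.two_pi_pos.le⟩),
    fun x => ?_⟩
  obtain ⟨y, hy, hxy⟩ := hp.exists_mem_Ioc Real.two_pi_pos x 0
  rw [hxy]
  exact hB y ⟨hy.1.le, hy.2⟩

/-- The function radiated by the density `f` through the kernel `K`. -/
noncomputable def kernelIntegral (f K : ℝ → ℂ) (φ : ℝ) : ℂ :=
  ∫ t in (-π)..π, f t * K (t - φ)

theorem continuous_kernelIntegral {f K : ℝ → ℂ} (hf : IntervalIntegrable f volume (-π) π)
    (hK : Continuous K) (hp : Function.Periodic K (2 * π)) : Continuous (kernelIntegral f K) := by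
  obtain ⟨B, _, hB⟩ := exists_norm_le_of_periodic hK hp
  have hle : -π ≤ π := by linarith [Real.pi_pos]
  refine intervalIntegral.continuous_of_dominated_interval (bound := fun t => ‖f t‖ * B)
    (fun φ => ?_) (fun φ => Eventually.of_forall fun t _ => ?_) (hf.norm.mul_const B)
    (Eventually.of_forall fun t _ => by fun_prop)
  · rw [Set.uIoc_of_le hle]
    exact hf.1.aestronglyMeasurable.mul (Continuous.aestronglyMeasurable (by fun_prop))
  · rw [norm_mul]
    gcongr
    exact hB _

theorem kernelIntegral_periodic (f : ℝ → ℂ) {K : ℝ → ℂ} (hp : Function.Periodic K (2 * π)) :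
    Function.Periodic (kernelIntegral f K) (2 * π) := by
  intro φ
  simp only [kernelIntegral]
  congr 1; ext t
  rw [← hp (t - (φ + 2 * π))]
  congr 2; ring

theorem fourierInt_comp_sub {K : ℝ → ℂ} (hp : Function.Periodic K (2 * π)) (n : ℤ) (t : ℝ) :
    fourierInt (fun φ => K (t - φ)) n
      = Complex.exp (-(Complex.I * n * t)) * fourierInt K (-n) := by
  have hT : ∀ u : ℝ, u - π + 2 * π = u + π := fun u => by ring
  have hper : Function.Periodic (fun u : ℝ => K u * Complex.exp (-(Complex.I * (-n : ℤ) * u)))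
      (2 * π) := hp.mul (exp_neg_I_mul_periodic (-n))
  have h1 := hper.intervalIntegral_add_eq (t - π) (0 - π)
  rw [hT, hT, zero_sub, zero_add] at h1
  rw [fourierInt, fourierInt, ← h1, ← intervalIntegral.integral_const_mul,
    ← sub_neg_eq_add t π,
    ← intervalIntegral.integral_comp_sub_left (fun u => Complex.exp (-(Complex.I * n * t)) *
      (K u * Complex.exp (-(Complex.I * (-n : ℤ) * u)))) t]
  refine intervalIntegral.integral_congr fun φ _ => ?_
  rw [mul_left_comm, ← Complex.exp_add]
  congr 2
  push_cast; ring

theorem fourierInt_kernelIntegral {f K : ℝ → ℂ} (hf : IntervalIntegrable f volume (-π) π)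
    (hK : Continuous K) (hp : Function.Periodic K (2 * π)) (n : ℤ) :
    fourierInt (kernelIntegral f K) n = fourierInt f n * fourierInt K (-n) := by
  obtain ⟨B, hB0, hB⟩ := exists_norm_le_of_periodic hK hp
  have hle : -π ≤ π := by linarith [Real.pi_pos]
  have hfI : Integrable f (volume.restrict (Set.Ioc (-π) π)) := hf.1
  have hswap := intervalIntegral_integral_swap (μ := volume.restrict (Set.Ioc (-π) π))
    (f := fun φ t => f t * (K (t - φ) * Complex.exp (-(Complex.I * n * φ))))
    (g := fun t => ‖f t‖ * B) ?_ (hfI.norm.mul_const B) ?_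
  · simp only [← intervalIntegral.integral_of_le hle] at hswap
    calc fourierInt (kernelIntegral f K) n
        = ∫ φ in (-π)..π, ∫ t in (-π)..π,
            f t * (K (t - φ) * Complex.exp (-(Complex.I * n * φ))) := by
          refine intervalIntegral.integral_congr fun φ _ => ?_
          simp only [kernelIntegral, ← mul_assoc, intervalIntegral.integral_mul_const]
      _ = ∫ t in (-π)..π, (f t * Complex.exp (-(Complex.I * n * t))) * fourierInt K (-n) := by
          rw [hswap]
          refine intervalIntegral.integral_congr fun t _ => ?_
          simp only [intervalIntegral.integral_const_mul]
          rw [mul_assoc, ← fourierInt_comp_sub hp]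
          rfl
      _ = _ := by rw [intervalIntegral.integral_mul_const]; rfl
  · refine hfI.aestronglyMeasurable.comp_snd.mul (Continuous.aestronglyMeasurable ?_)
    fun_prop
  · refine Eventually.of_forall fun t φ => ?_
    rw [norm_mul, norm_mul, norm_exp_neg_I_mul, mul_one]
    gcongr
    exact hB _

/-! ### Absolutely convergent Fourier series -/

theorem norm_mul_exp_I_mul (c : ℂ) (n : ℤ) (x : ℝ) :
    ‖c * Complex.exp (Complex.I * n * x)‖ = ‖c‖ := by
  rw [norm_mul, show Complex.I * n * x = Complex.I * ((n * x : ℝ) : ℂ) by push_cast; ring,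
    Complex.norm_exp_I_mul_ofReal, mul_one]

theorem continuous_fourierSum {c : ℤ → ℂ} (hc : Summable fun n => ‖c n‖) :
    Continuous (fourierSum c) :=
  continuous_tsum (fun n => by fun_prop) hc fun n x => (norm_mul_exp_I_mul _ n x).le

theorem fourierInt_exp (m n : ℤ) :
    fourierInt (fun x => Complex.exp (Complex.I * m * x)) n = if m = n then 2 * (π : ℂ) else 0 := by
  rw [fourierInt]
  simp only [← Complex.exp_add]
  split_ifs with h
  · subst h
    simp only [add_neg_cancel, Complex.exp_zero, intervalIntegral.integral_const, sub_neg_eq_add,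
      Complex.real_smul, mul_one]
    push_cast; ring
  · have hne : (m : ℂ) - n ≠ 0 := sub_ne_zero.2 (by exact_mod_cast h)
    have e : ∀ x : ℝ, Complex.I * m * x + -(Complex.I * n * x) = (Complex.I * (m - n)) * x :=
      fun x => by ring
    simp only [e]
    rw [integral_exp_mul_complex (mul_ne_zero Complex.I_ne_zero hne), div_eq_zero_iff]
    left
    rw [sub_eq_zero, Complex.exp_eq_exp_iff_exists_int]
    exact ⟨m - n, by push_cast; ring⟩

theorem fourierInt_fourierSum {c : ℤ → ℂ} (hc : Summable fun n => ‖c n‖) (n : ℤ) :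
    fourierInt (fourierSum c) n = 2 * π * c n := by
  have hle : -π ≤ π := by linarith [Real.pi_pos]
  have hnorm : ∀ (m : ℤ) (x : ℝ), ‖c m * Complex.exp (Complex.I * m * x)
      * Complex.exp (-(Complex.I * n * x))‖ = ‖c m‖ := fun m x => by
    rw [norm_mul, norm_mul_exp_I_mul, norm_exp_neg_I_mul, mul_one]
  have h := hasSum_integral_of_summable_integral_norm (μ := volume.restrict (Set.Ioc (-π) π))
    (F := fun (m : ℤ) (x : ℝ) => c m * Complex.exp (Complex.I * m * x)
      * Complex.exp (-(Complex.I * n * x)))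
    (fun m => Continuous.integrableOn_Ioc (by fun_prop)) (by
      simp only [hnorm, integral_const]
      exact hc.mul_left _)
  simp only [tsum_mul_right, ← intervalIntegral.integral_of_le hle] at h
  have h2 : ∀ m : ℤ, ∫ x in (-π)..π, c m * Complex.exp (Complex.I * m * x)
      * Complex.exp (-(Complex.I * n * x)) = if m = n then 2 * π * c n else 0 := by
    intro m
    have := fourierInt_const_mul (c m) (fun x => Complex.exp (Complex.I * m * x)) n
    rw [fourierInt_exp] at this
    refine this.trans ?_
    split_ifs with hmn
    · subst hmn; ring
    · ring
  simp only [h2] at h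
  exact h.unique (hasSum_ite_eq n _)

/-! ### The addition theorem -/

theorem continuousOn_hankel2 (n : ℤ) : ContinuousOn (hankel2 n) (Set.Ioi 0) := fun _ hx =>
  (hasDerivAt_hankel2 n hx).continuousAt.continuousWithinAt

theorem sq_add_sq_sub_pos {a b : ℝ} (ha : 0 ≤ a) (hb : 0 ≤ b) (hab : a ≠ b) (θ : ℝ) :
    0 < a ^ 2 + b ^ 2 - 2 * a * b * Real.cos θ := by
  have h1 : 0 < (a - b) ^ 2 := by
    have := sub_ne_zero.2 hab
    positivity
  nlinarith [mul_nonneg (mul_nonneg ha hb) (sub_nonneg.2 (Real.cos_le_one θ))]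

theorem dist2_pos {a b : ℝ} (ha : 0 ≤ a) (hb : 0 ≤ b) (hab : a ≠ b) (θ : ℝ) : 0 < dist2 a b θ :=
  Real.sqrt_pos.2 (sq_add_sq_sub_pos ha hb hab θ)

theorem dist2_comm (a b θ : ℝ) : dist2 a b θ = dist2 b a θ := by
  rw [dist2, dist2]; congr 1; ring

theorem dist2_mul {k : ℝ} (hk : 0 ≤ k) (a b θ : ℝ) :
    dist2 (k * a) (k * b) θ = k * dist2 a b θ := by
  rw [dist2, dist2, show (k * a) ^ 2 + (k * b) ^ 2 - 2 * (k * a) * (k * b) * Real.cos θ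
    = k ^ 2 * (a ^ 2 + b ^ 2 - 2 * a * b * Real.cos θ) by ring, Real.sqrt_mul (sq_nonneg k),
    Real.sqrt_sq hk]

theorem norm_sub_mul_exp (a b θ : ℝ) :
    ‖(b : ℂ) - a * Complex.exp (Complex.I * θ)‖ = dist2 a b θ := by
  have h : (b : ℂ) - a * Complex.exp (Complex.I * θ)
      = ((b - a * Real.cos θ : ℝ) : ℂ) + ((-(a * Real.sin θ) : ℝ) : ℂ) * Complex.I := by
    rw [mul_comm Complex.I, Complex.exp_mul_I]; push_cast; ring
  rw [h, Complex.norm_add_mul_I, dist2]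
  congr 1
  nlinarith [Real.sin_sq_add_cos_sq θ]

theorem fourierInt_exp_mul_sin (a : ℝ) (n : ℤ) :
    fourierInt (fun θ => Complex.exp (Complex.I * (a * Real.sin θ))) n
      = 2 * π * besselJ n a := by
  set f : ℝ → ℂ := fun θ => Complex.exp (Complex.I * (a * Real.sin θ))
    * Complex.exp (-(Complex.I * n * θ)) with hf
  have hc : Continuous f := by simp only [hf]; fun_prop
  have h1 : ∫ θ in (-π)..0, f θ = ∫ θ in (0 : ℝ)..π, f (-θ) := by
    rw [intervalIntegral.integral_comp_neg, neg_zero]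
  have h2 : ∀ θ : ℝ, f (-θ) + f θ = 2 * (Real.cos (n * θ - a * Real.sin θ) : ℂ) := by
    intro θ
    simp only [hf, ← Complex.exp_add]
    rw [Real.sin_neg, Complex.ofReal_cos, Complex.two_cos]
    congr 2 <;> · push_cast; ring
  rw [fourierInt, ← intervalIntegral.integral_add_adjacent_intervals (b := 0)
    (hc.intervalIntegrable _ _) (hc.intervalIntegrable _ _), h1,
    ← intervalIntegral.integral_add (Continuous.intervalIntegrable (by fun_prop) _ _)
      (hc.intervalIntegrable _ _)]
  simp only [h2]
  rw [intervalIntegral.integral_const_mul, intervalIntegral.integral_ofReal, besselJ]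
  have hpi : (π : ℂ) ≠ 0 := by exact_mod_cast Real.pi_ne_zero
  push_cast
  field_simp

/-- The generating function of the Bessel functions: the integral of the entire, `2πi`-periodic
function `exp (a sinh u - n u)` over a vertical segment of length `2π` does not depend on the
segment. -/
theorem integral_exp_sinh (a : ℝ) (n : ℤ) (w : ℂ) :
    ∫ θ in (-π)..π, Complex.exp (a * Complex.sinh (w + Complex.I * θ)
      - n * (w + Complex.I * θ)) = 2 * π * besselJ n a := by
  set Φ : ℂ → ℂ := fun u => Complex.exp (a * Complex.sinh u - n * u) with hΦ
  set Φ' : ℂ → ℂ := fun u => Complex.exp (a * Complex.sinh u - n * u) * (a * Complex.cosh u - n * 1)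
    with hΦ'
  have hΦd : ∀ u, HasDerivAt Φ (Φ' u) u := fun u =>
    (((Complex.hasDerivAt_sinh u).const_mul (a : ℂ)).sub ((hasDerivAt_id u).const_mul (n : ℂ))).cexp
  have hΦc : Continuous Φ := by simp only [hΦ]; fun_prop
  have hΦ'c : Continuous Φ' := by simp only [hΦ']; fun_prop
  have hd : ∀ s : ℝ, HasDerivAt (fun s : ℝ => ∫ θ in (-π)..π, Φ (s * w + Complex.I * θ))
      (∫ θ in (-π)..π, w * Φ' (s * w + Complex.I * θ)) s := by
    intro s
    refine hasDerivAt_intervalIntegral_of_continuousOn (U := Set.univ)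
      (F := fun s θ => Φ (s * w + Complex.I * θ))
      (F' := fun s θ => w * Φ' (s * w + Complex.I * θ)) univ_mem (fun s _ => by fun_prop)
      (fun s _ θ => ?_) (Continuous.continuousOn (by fun_prop))
    have h1 : HasDerivAt (fun s : ℝ => (s : ℂ) * w + Complex.I * θ) (1 * w) s :=
      ((Complex.ofRealCLM.hasDerivAt (x := s)).mul_const w).add_const _
    exact ((hΦd _).comp s h1).congr_deriv (by ring)
  have h0 : ∀ s : ℝ, ∫ θ in (-π)..π, w * Φ' (s * w + Complex.I * θ) = 0 := by
    intro s
    have h2 : ∀ θ : ℝ, HasDerivAt (fun θ : ℝ => -Complex.I * w * Φ (s * w + Complex.I * θ))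
        (w * Φ' (s * w + Complex.I * θ)) θ := by
      intro θ
      have h1 : HasDerivAt (fun θ : ℝ => (s : ℂ) * w + Complex.I * θ) (Complex.I * 1) θ :=
        ((Complex.ofRealCLM.hasDerivAt (x := θ)).const_mul _).const_add _
      refine (((hΦd _).comp θ h1).const_mul (-Complex.I * w)).congr_deriv ?_
      linear_combination (-w * Φ' (s * w + Complex.I * θ)) * Complex.I_mul_I
    have hΦp : Φ (s * w + Complex.I * (π : ℝ)) = Φ (s * w + Complex.I * (-π : ℝ)) := by
      have e : (s : ℂ) * w + Complex.I * (π : ℝ)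
          = (s * w + Complex.I * (-π : ℝ)) + π * Complex.I + π * Complex.I := by
        push_cast; ring
      simp only [hΦ]
      rw [e, Complex.sinh_add_pi_mul_I, Complex.sinh_add_pi_mul_I, neg_neg,
        Complex.exp_eq_exp_iff_exists_int]
      exact ⟨-n, by push_cast; ring⟩
    rw [intervalIntegral.integral_eq_sub_of_hasDerivAt (fun θ _ => h2 θ)
      (Continuous.intervalIntegrable (by fun_prop) _ _), hΦp, sub_self]
  have hconst := is_const_of_deriv_eq_zero (fun s => (hd s).differentiableAt)
    (fun s => (hd s).deriv.trans (h0 s)) 1 0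
  simp only [Complex.ofReal_one, one_mul, Complex.ofReal_zero, zero_mul, zero_add] at hconst
  refine hconst.trans (Eq.trans ?_ (fourierInt_exp_mul_sin a n))
  refine intervalIntegral.integral_congr fun θ _ => ?_
  simp only [hΦ]
  rw [← Complex.exp_add, mul_comm Complex.I (θ : ℂ), Complex.sinh_mul_I, Complex.ofReal_sin]
  congr 1; ring

theorem contourIntegrand_pi_sub (n : ℤ) (p q w : ℂ) :
    contourIntegrand n p q (Complex.I * π - w) = (-1) ^ n * contourIntegrand (-n) q p w := by
  have h1 : Complex.exp (Complex.I * π - w) = -Complex.exp (-w) := by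
    rw [sub_eq_add_neg, Complex.exp_add, mul_comm Complex.I, Complex.exp_pi_mul_I]; ring
  have h2 : Complex.exp (-(Complex.I * π - w)) = -Complex.exp w := by
    rw [neg_sub, sub_eq_add_neg, Complex.exp_add, Complex.exp_neg, mul_comm Complex.I,
      Complex.exp_pi_mul_I]; norm_num
  rw [contourIntegrand, contourIntegrand, h1, h2, ← exp_int_mul_I_mul_pi, ← Complex.exp_add]
  congr 1; push_cast; ring

theorem contourIntegrand_zero_mul_exp (n : ℤ) (a b θ : ℝ) (w : ℂ) :
    contourIntegrand 0 ((b - a * Complex.exp (Complex.I * θ)) / 2)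
        ((b - a * Complex.exp (-(Complex.I * θ))) / 2) w * Complex.exp (-(Complex.I * n * θ))
      = contourIntegrand n (b / 2) (b / 2) w * Complex.exp (a * Complex.sinh (w + Complex.I * θ)
          - n * (w + Complex.I * θ)) := by
  have hs : Complex.sinh (w + Complex.I * θ) = (Complex.exp w * Complex.exp (Complex.I * θ)
      - Complex.exp (-w) * Complex.exp (-(Complex.I * θ))) / 2 := by
    rw [Complex.sinh, ← Complex.exp_add, ← Complex.exp_add, neg_add]
  rw [contourIntegrand, contourIntegrand, ← Complex.exp_add, ← Complex.exp_add, hs]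
  congr 1; push_cast; ring

/-- Each piece of the contour contributes to the `n`-th Fourier coefficient of `H_0` of the distance
`J_n(a)` times its contribution to `H_n(b)`. -/
theorem fourierInt_integral_contourIntegrand (n : ℤ) (a b : ℝ) {μ : Measure ℝ} [SFinite μ]
    {w : ℝ → ℂ} (hw : Continuous w) {g : ℝ → ℝ} (hg : Integrable g μ)
    (h : ∀ᵐ t ∂μ, ∀ θ : ℝ, ‖contourIntegrand 0 ((b - a * Complex.exp (Complex.I * θ)) / 2)
        ((b - a * Complex.exp (-(Complex.I * θ))) / 2) (w t)‖ ≤ g t) :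
    fourierInt (fun θ => ∫ t, contourIntegrand 0 ((b - a * Complex.exp (Complex.I * θ)) / 2)
        ((b - a * Complex.exp (-(Complex.I * θ))) / 2) (w t) ∂μ) n
      = 2 * π * besselJ n a * ∫ t, contourIntegrand n (b / 2) (b / 2) (w t) ∂μ := by
  rw [fourierInt]
  simp only [← integral_mul_const]
  rw [intervalIntegral_integral_swap (g := g) (Continuous.aestronglyMeasurable (by fun_prop)) hg,
    ← integral_const_mul]
  · refine integral_congr_ae (Eventually.of_forall fun t => ?_)
    simp only [contourIntegrand_zero_mul_exp, intervalIntegral.integral_const_mul,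
      integral_exp_sinh]
    ring
  · filter_upwards [h] with t ht θ
    rw [norm_mul, norm_exp_neg_I_mul, mul_one]
    exact ht θ

/-- The field of a line source at distance `dist2 a b θ`, as a function of the angle `θ`. -/
noncomputable def electricKernel (a b θ : ℝ) : ℂ := hankel2 0 (dist2 a b θ)

/-- **Graf's addition theorem** for `H_0`, in terms of Fourier coefficients. -/
theorem fourierInt_electricKernel (n : ℤ) {a b : ℝ} (ha : 0 ≤ a) (hab : a < b) :
    fourierInt (electricKernel a b) n = 2 * π * (besselJ n a * hankel2 n b) := by
  have hb : 0 < b := ha.trans_lt hab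
  set p : ℝ → ℂ := fun θ => (b - a * Complex.exp (Complex.I * θ)) / 2 with hp
  set q : ℝ → ℂ := fun θ => (b - a * Complex.exp (-(Complex.I * θ))) / 2 with hq
  have hpc : Continuous p := by simp only [hp]; fun_prop
  have hqc : Continuous q := by simp only [hq]; fun_prop
  have e1 : ∀ θ : ℝ, (Complex.exp (Complex.I * θ)).re = Real.cos θ := fun θ => by
    rw [mul_comm, Complex.exp_ofReal_mul_I_re]
  have e2 : ∀ θ : ℝ, (Complex.exp (-(Complex.I * θ))).re = Real.cos θ := fun θ => by
    rw [show -(Complex.I * θ) = ((-θ : ℝ) : ℂ) * Complex.I by push_cast; ring,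
      Complex.exp_ofReal_mul_I_re, Real.cos_neg]
  have re_div : ∀ z : ℂ, (z / 2).re = z.re / 2 := fun z => by
    rw [show (2 : ℂ) = ((2 : ℝ) : ℂ) by norm_num, Complex.div_ofReal_re]
  have hpre : ∀ θ, (b - a) / 2 ≤ (p θ).re := fun θ => by
    simp only [hp, re_div, Complex.sub_re, Complex.ofReal_re, Complex.re_ofReal_mul, e1]
    nlinarith [Real.cos_le_one θ]
  have hqre : ∀ θ, (b - a) / 2 ≤ (q θ).re := fun θ => by
    simp only [hq, re_div, Complex.sub_re, Complex.ofReal_re, Complex.re_ofReal_mul, e2]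
    nlinarith [Real.cos_le_one θ]
  have hc : 0 < (b - a) / 2 := by linarith
  have hpn : ∀ θ, ‖p θ‖ ≤ (a + b) / 2 := fun θ => by
    have h1 : ‖(a : ℂ) * Complex.exp (Complex.I * θ)‖ = a := by
      rw [norm_mul, Complex.norm_exp_I_mul_ofReal, mul_one, Complex.norm_real, Real.norm_eq_abs,
        abs_of_nonneg ha]
    have h2 := norm_sub_le (b : ℂ) (a * Complex.exp (Complex.I * θ))
    rw [h1, Complex.norm_real, Real.norm_eq_abs, abs_of_pos hb] at h2
    simp only [hp, norm_div, Complex.norm_two]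
    linarith
  have hqn : ∀ θ, ‖q θ‖ ≤ (a + b) / 2 := fun θ => by
    have := hpn (-θ)
    simp only [hp, Complex.ofReal_neg, mul_neg] at this
    exact this
  have hdp : ∀ y : ℝ, HasDerivAt p (-(a * (Complex.exp (Complex.I * y) * Complex.I)) / 2) y := by
    intro y
    have h1 : HasDerivAt (fun y : ℝ => Complex.I * (y : ℂ)) (Complex.I * 1) y :=
      (Complex.ofRealCLM.hasDerivAt (x := y)).const_mul _
    exact (((h1.cexp.const_mul (a : ℂ)).const_sub (b : ℂ)).div_const 2).congr_deriv (by ring)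
  have hdq : ∀ y : ℝ, HasDerivAt q (a * (Complex.exp (-(Complex.I * y)) * Complex.I) / 2) y := by
    intro y
    have h1 : HasDerivAt (fun y : ℝ => -(Complex.I * (y : ℂ))) (-(Complex.I * 1)) y :=
      ((Complex.ofRealCLM.hasDerivAt (x := y)).const_mul _).neg
    exact (((h1.cexp.const_mul (a : ℂ)).const_sub (b : ℂ)).div_const 2).congr_deriv (by ring)
  have hker : electricKernel a b = fun θ => sommerfeld 0 (p θ) (q θ) := by
    ext θ
    have hz : 0 < ((b : ℂ) - a * Complex.exp (Complex.I * θ)).re := by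
      have h1 := hpre θ
      simp only [hp, re_div] at h1
      linarith
    rw [electricKernel, ← norm_sub_mul_exp, ← sommerfeld_zero_eq_hankel2 hz]
    simp only [hp, hq]
    congr 2
    rw [map_sub, map_mul, Complex.conj_ofReal, Complex.conj_ofReal, ← Complex.exp_conj, map_mul,
      Complex.conj_I, Complex.conj_ofReal, neg_mul]
  have iA : IntervalIntegrable (fun θ => arcIntegral 0 (p θ) (q θ)) volume (-π) π :=
    Continuous.intervalIntegrable (continuous_iff_continuousAt.2 fun θ =>
      (hasDerivAt_arcIntegral 0 hdp hdq (by fun_prop) (by fun_prop)).continuousAt) _ _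
  have iT : IntervalIntegrable (fun θ => tailIntegral 0 (p θ) (q θ)) volume (-π) π :=
    Continuous.intervalIntegrable (continuous_iff_continuousAt.2 fun θ =>
      (hasDerivAt_tailIntegral 0 hdp hdq (by fun_prop) (by fun_prop)
        (hc.trans_le (hpre θ))).continuousAt) _ _
  have iB : IntervalIntegrable (fun θ => tailIntegral 0 (q θ) (p θ)) volume (-π) π :=
    Continuous.intervalIntegrable (continuous_iff_continuousAt.2 fun θ =>
      (hasDerivAt_tailIntegral 0 hdq hdp (by fun_prop) (by fun_prop)
        (hc.trans_le (hqre θ))).continuousAt) _ _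
  have fA : fourierInt (fun θ => arcIntegral 0 (p θ) (q θ)) n
      = 2 * π * besselJ n a * arcIntegral n (b / 2) (b / 2) := by
    simp only [arcIntegral, intervalIntegral.integral_of_le Real.pi_pos.le]
    refine fourierInt_integral_contourIntegrand n a b (μ := volume.restrict (Set.Ioc 0 π))
      (w := fun s => Complex.I * s) (by fun_prop) (g := fun _ => Real.exp (a + b))
      (integrable_const _) (Eventually.of_forall fun s θ => ?_)
    change ‖contourIntegrand 0 (p θ) (q θ) (Complex.I * s)‖ ≤ _
    rw [contourIntegrand, Complex.norm_exp]
    apply Real.exp_le_exp.2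
    refine (Complex.re_le_norm _).trans ?_
    rw [Int.cast_zero, zero_mul, zero_sub]
    refine (norm_add_le _ _).trans ?_
    have h3 : ‖Complex.exp (-(Complex.I * s))‖ = 1 := by
      rw [show -(Complex.I * s) = Complex.I * ((-s : ℝ) : ℂ) by push_cast; ring,
        Complex.norm_exp_I_mul_ofReal]
    rw [norm_neg, norm_mul, norm_mul, Complex.norm_exp_I_mul_ofReal, h3]
    linarith [hpn θ, hqn θ]
  have fT : fourierInt (fun θ => tailIntegral 0 (p θ) (q θ)) n
      = 2 * π * besselJ n a * tailIntegral n (b / 2) (b / 2) := by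
    refine fourierInt_integral_contourIntegrand n a b (μ := volume.restrict (Set.Ioi 0))
      (w := fun t => t) (by fun_prop)
      ((integrableOn_exp_sub_mul_exp 0 hc).const_mul (Real.exp ((a + b) / 2))) ?_
    refine (ae_restrict_mem measurableSet_Ioi).mono fun t ht θ => ?_
    have := norm_contourIntegrand_le 0 (hpre θ) (hqn θ) (le_of_lt ht)
    rwa [Int.cast_zero] at this
  have fB : fourierInt (fun θ => tailIntegral 0 (q θ) (p θ)) n
      = 2 * π * besselJ n a * ((-1) ^ n * tailIntegral (-n) (b / 2) (b / 2)) := by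
    have h1 : ∀ θ t, contourIntegrand 0 (q θ) (p θ) t
        = contourIntegrand 0 (p θ) (q θ) (Complex.I * π - t) := fun θ t => by
      rw [contourIntegrand_pi_sub]; simp
    simp only [tailIntegral, h1]
    rw [← integral_const_mul]
    simp only [← contourIntegrand_pi_sub]
    refine fourierInt_integral_contourIntegrand n a b (μ := volume.restrict (Set.Ioi 0))
      (w := fun t => Complex.I * π - t) (by fun_prop)
      ((integrableOn_exp_sub_mul_exp 0 hc).const_mul (Real.exp ((a + b) / 2))) ?_
    refine (ae_restrict_mem measurableSet_Ioi).mono fun t ht θ => ?_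
    have := norm_contourIntegrand_le 0 (hqre θ) (hpn θ) (le_of_lt ht)
    rw [Int.cast_zero, h1] at this
    exact this
  rw [hker, hankel2_eq_sommerfeld n hb]
  simp only [sommerfeld, zpow_zero, one_mul, neg_zero]
  rw [fourierInt_const_mul, fourierInt_add (iA.add (iT.const_mul _)) (iB.const_mul _),
    fourierInt_add iA (iT.const_mul _), fourierInt_const_mul, fourierInt_const_mul, fA, fT, fB]
  ring

theorem continuous_dist2 (a b : ℝ) : Continuous (dist2 a b) := by
  unfold dist2; fun_prop

theorem continuous_electricKernel {a b : ℝ} (ha : 0 ≤ a) (hb : 0 ≤ b) (hab : a ≠ b) :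
    Continuous (electricKernel a b) :=
  (continuousOn_hankel2 0).comp_continuous (continuous_dist2 a b) (dist2_pos ha hb hab)

theorem electricKernel_comm (a b : ℝ) : electricKernel a b = electricKernel b a := by
  ext θ; rw [electricKernel, electricKernel, dist2_comm]

theorem dist2_periodic (a b : ℝ) : Function.Periodic (dist2 a b) (2 * π) := fun θ => by
  rw [dist2, dist2, Real.cos_add_two_pi]

theorem electricKernel_periodic (a b : ℝ) : Function.Periodic (electricKernel a b) (2 * π) :=
  fun θ => by rw [electricKernel, electricKernel, dist2_periodic]

/-- The kernel of the field of a magnetic current on the circle of radius `a`, at distance `b` from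
the axis: the negative of the derivative of `electricKernel a b` with respect to `a`. -/
noncomputable def magneticKernel (a b θ : ℝ) : ℂ :=
  (((a - b * Real.cos θ) / dist2 a b θ : ℝ) : ℂ) * hankel2 1 (dist2 a b θ)

theorem hasDerivAt_hankel2_zero {x : ℝ} (hx : 0 < x) :
    HasDerivAt (hankel2 0) (-hankel2 1 x) x := by
  refine (hasDerivAt_hankel2 0 hx).congr_deriv ?_
  rw [zero_sub, zero_add, hankel2_neg]
  norm_num
  ring

theorem hasDerivAt_electricKernel {a b : ℝ} (ha : 0 ≤ a) (hb : 0 ≤ b) (hab : a ≠ b) (θ : ℝ) :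
    HasDerivAt (fun x => electricKernel x b θ) (-magneticKernel a b θ) a := by
  have hpos := sq_add_sq_sub_pos ha hb hab θ
  have h1 : HasDerivAt (fun x : ℝ => x ^ 2 + b ^ 2 - 2 * x * b * Real.cos θ)
      (2 * a - 2 * b * Real.cos θ) a := by
    have := (((hasDerivAt_id a).pow 2).add_const (b ^ 2)).sub
      ((((hasDerivAt_id a).const_mul 2).mul_const b).mul_const (Real.cos θ))
    refine HasDerivAt.congr_deriv this ?_
    simp
  have h2 : HasDerivAt (fun x => dist2 x b θ) ((a - b * Real.cos θ) / dist2 a b θ) a := by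
    refine (h1.sqrt hpos.ne').congr_deriv ?_
    rw [dist2, mul_assoc 2 b, ← mul_sub, mul_div_mul_left _ _ two_ne_zero]
  refine ((hasDerivAt_hankel2_zero (dist2_pos ha hb hab θ)).scomp a h2).congr_deriv ?_
  rw [magneticKernel, Complex.real_smul]; ring

theorem continuousOn_magneticKernel {b : ℝ} (hb : 0 ≤ b) {U : Set ℝ}
    (hU : ∀ a ∈ U, 0 ≤ a ∧ a ≠ b) :
    ContinuousOn (fun z : ℝ × ℝ => magneticKernel z.1 b z.2) (U ×ˢ Set.univ) := by
  have hd : Continuous fun z : ℝ × ℝ => dist2 z.1 b z.2 := by unfold dist2; fun_prop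
  have hpos : ∀ z ∈ U ×ˢ (Set.univ : Set ℝ), 0 < dist2 z.1 b z.2 := fun z hz =>
    dist2_pos (hU z.1 hz.1).1 hb (hU z.1 hz.1).2 z.2
  refine ContinuousOn.mul (Complex.continuous_ofReal.comp_continuousOn
    (ContinuousOn.div (by fun_prop) hd.continuousOn fun z hz => (hpos z hz).ne')) ?_
  exact (continuousOn_hankel2 1).comp hd.continuousOn hpos

theorem continuous_magneticKernel {a b : ℝ} (ha : 0 ≤ a) (hb : 0 ≤ b) (hab : a ≠ b) :
    Continuous (magneticKernel a b) := by
  rw [← continuousOn_univ]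
  exact (continuousOn_magneticKernel hb (U := {a}) (by rintro _ rfl; exact ⟨ha, hab⟩)).comp
    (f := fun t => (a, t)) (by fun_prop) (fun t _ => ⟨rfl, trivial⟩)

theorem magneticKernel_periodic (a b : ℝ) : Function.Periodic (magneticKernel a b) (2 * π) :=
  fun θ => by rw [magneticKernel, magneticKernel, dist2_periodic, Real.cos_add_two_pi]

theorem hasDerivAt_fourierInt_electricKernel (n : ℤ) {a b : ℝ} {U : Set ℝ} (hUa : U ∈ 𝓝 a)
    (hb : 0 ≤ b) (hU : ∀ a ∈ U, 0 ≤ a ∧ a ≠ b) :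
    HasDerivAt (fun x => fourierInt (electricKernel x b) n)
      (-fourierInt (magneticKernel a b) n) a := by
  have h := hasDerivAt_intervalIntegral_of_continuousOn (a := -π) (b := π) hUa
    (F := fun x θ => electricKernel x b θ * Complex.exp (-(Complex.I * n * θ)))
    (F' := fun x θ => -magneticKernel x b θ * Complex.exp (-(Complex.I * n * θ)))
    (fun x hx => (continuous_electricKernel (hU x hx).1 hb (hU x hx).2).mul (by fun_prop))
    (fun x hx θ => (hasDerivAt_electricKernel (hU x hx).1 hb (hU x hx).2 θ).mul_const _)
    ((continuousOn_magneticKernel hb hU).neg.mul (Continuous.continuousOn (by fun_prop)))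
  refine HasDerivAt.congr_deriv h ?_
  exact fourierInt_neg _ n

theorem fourierInt_magneticKernel_of_lt (n : ℤ) {a b : ℝ} (ha : 0 < a) (hab : a < b) :
    fourierInt (magneticKernel a b) n = -(2 * π * (besselJ' n a * hankel2 n b)) := by
  have h1 := hasDerivAt_fourierInt_electricKernel n (Ioo_mem_nhds ha hab) (ha.trans hab).le
    (fun x hx => ⟨hx.1.le, hx.2.ne⟩)
  have h2 : HasDerivAt (fun x => 2 * π * ((besselJ n x : ℂ) * hankel2 n b))
      (2 * π * ((besselJ' n a : ℂ) * hankel2 n b)) a :=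
    (((hasDerivAt_besselJ n ha).differentiableAt.hasDerivAt.ofReal_comp).mul_const _).const_mul _
  have h3 := h1.unique (h2.congr_of_eventuallyEq (by
    filter_upwards [Ioo_mem_nhds ha hab] with x hx
    exact fourierInt_electricKernel n hx.1.le hx.2))
  rw [← h3, neg_neg]

theorem fourierInt_magneticKernel_of_gt (n : ℤ) {a b : ℝ} (hb : 0 ≤ b) (hab : b < a) :
    fourierInt (magneticKernel a b) n = -(2 * π * (besselJ n b * hankel2' n a)) := by
  have h1 := hasDerivAt_fourierInt_electricKernel n (Ioi_mem_nhds hab) hb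
    (fun x hx => ⟨hb.trans (le_of_lt hx), ne_of_gt hx⟩)
  have h2 : HasDerivAt (fun x => 2 * π * ((besselJ n b : ℂ) * hankel2 n x))
      (2 * π * ((besselJ n b : ℂ) * hankel2' n a)) a :=
    ((hasDerivAt_hankel2 n (hb.trans_lt hab)).differentiableAt.hasDerivAt.const_mul _).const_mul _
  have h3 := h1.unique (h2.congr_of_eventuallyEq (by
    filter_upwards [Ioi_mem_nhds hab] with x hx
    rw [electricKernel_comm]
    exact fourierInt_electricKernel n hb hx))
  rw [← h3, neg_neg]

/-! ### Asymptotic equivalence of even sequences over the integers -/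

/-- For even sequences over `ℤ` it suffices to compare them at positive indices. -/
theorem isEquivalent_cofinite_of_tendsto_div {u v : ℤ → ℂ} (hu : ∀ n, u (-n) = u n)
    (hv : ∀ n, v (-n) = v n)
    (h : Tendsto (fun n : ℕ => u (n + 1) / v (n + 1)) atTop (𝓝 1)) : u ~[cofinite] v := by
  have h1 : (fun n : ℕ => u (n + 1)) ~[atTop] (fun n : ℕ => v (n + 1)) :=
    isEquivalent_of_tendsto_one h
  have htop : (fun n => u n - v n) =o[atTop] v := by
    rw [← Nat.map_cast_int_atTop, isLittleO_map]
    have h2 : Tendsto (fun n : ℕ => n - 1) atTop atTop := tendsto_sub_atTop_nat 1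
    refine (h1.isLittleO.comp_tendsto h2).congr' ?_ ?_
    all_goals
      filter_upwards [eventually_ge_atTop 1] with n hn
      have : ((n - 1 : ℕ) : ℤ) + 1 = n := by omega
      simp [this]
  have hbot : (fun n => u n - v n) =o[atBot] v :=
    (htop.comp_tendsto tendsto_neg_atBot_atTop).congr (fun n => by simp [hu, hv])
      (fun n => by simp [hv])
  rw [IsEquivalent, Int.cofinite_eq]
  exact hbot.sup htop

theorem summable_pow_natAbs {r : ℝ} (h0 : 0 ≤ r) (h1 : r < 1) :
    Summable fun n : ℤ => r ^ n.natAbs := by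
  have := summable_geometric_of_lt_one h0 h1
  exact Summable.of_nat_of_neg (by simpa using this) (by simpa using this)

theorem summable_norm_of_isEquivalent {u : ℤ → ℂ} {w : ℤ → ℂ} {B r : ℝ} (h0 : 0 ≤ r) (h1 : r < 1)
    (h : u ~[cofinite] w) (hw : ∀ n, ‖w n‖ ≤ B * r ^ n.natAbs) : Summable fun n => ‖u n‖ := by
  have h2 : w =O[cofinite] fun n : ℤ => r ^ n.natAbs :=
    IsBigO.of_bound B (Eventually.of_forall fun n => by
      rw [Real.norm_of_nonneg (by positivity : 0 ≤ r ^ n.natAbs)]; exact hw n)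
  exact summable_of_isBigO (summable_pow_natAbs h0 h1) (h.isBigO.trans h2).norm_left

theorem tendsto_ofReal_besselJ_succ {x : ℝ} (hx : 0 < x) :
    Tendsto (fun n : ℕ => (besselJ (n + 1) x : ℂ) * (n + 1).factorial / (x / 2) ^ (n + 1)) atTop
      (𝓝 1) := by
  have := (Complex.continuous_ofReal.tendsto 1).comp (tendsto_besselJ_succ hx)
  rw [Complex.ofReal_one] at this
  exact this.congr fun n => by simp [Function.comp]

theorem tendsto_ofReal_besselJ'_succ {x : ℝ} (hx : 0 < x) :
    Tendsto (fun n : ℕ => (besselJ' (n + 1) x : ℂ) * n.factorial / (x / 2) ^ (n + 1)) atTop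
      (𝓝 (1 / x)) := by
  have := (Complex.continuous_ofReal.tendsto (1 / x)).comp (tendsto_besselJ'_succ hx)
  rw [Complex.ofReal_div, Complex.ofReal_one] at this
  exact this.congr fun n => by simp [Function.comp]

theorem neg_one_zpow_mul_self (n : ℤ) : (-1 : ℂ) ^ n * (-1) ^ n = 1 := by
  rw [← mul_zpow]; norm_num

namespace Cylinder

variable (C : Cylinder)

/-! ### The common denominator and the size of the coefficients -/

theorem k₁_pos : 0 < C.k₁ := mul_pos C.ω_pos (Real.sqrt_pos.2 (mul_pos C.ε₁_pos C.μ₁_pos))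

theorem k₂_pos : 0 < C.k₂ := mul_pos C.ω_pos (Real.sqrt_pos.2 (mul_pos C.ε₂_pos C.μ₂_pos))

theorem Z₁_pos : 0 < C.Z₁ := Real.sqrt_pos.2 (div_pos C.μ₁_pos C.ε₁_pos)

theorem Z₂_pos : 0 < C.Z₂ := Real.sqrt_pos.2 (div_pos C.μ₂_pos C.ε₂_pos)

/-- If `Δ_n` vanished, then so would its real part, which is the same expression with `J_n` in place
of `H_n`. The two equations are linear in `J_n` and `J_n'` at `k₂ρcyl`, with determinant a multiple
of the Wronskian at `k₁ρcyl`, so that `J_n` and `J_n'` would have a common zero. -/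
theorem denom_ne_zero (n : ℤ) : C.denom n ≠ 0 := by
  intro h
  have hx₁ := mul_pos C.k₁_pos C.ρcyl_pos
  have hx₂ := mul_pos C.k₂_pos C.ρcyl_pos
  have hW := besselJ_hankel2_wronskian n hx₁
  have hne := two_I_div_ne_zero hx₁
  have hZ₁ : (C.Z₁ : ℂ) ≠ 0 := by exact_mod_cast C.Z₁_pos.ne'
  have hZ₂ : (C.Z₂ : ℂ) ≠ 0 := by exact_mod_cast C.Z₂_pos.ne'
  set w : ℂ := -(2 * Complex.I / (π * (C.k₁ * C.ρcyl : ℝ)))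
  have hre : (C.Z₁ : ℂ) * besselJ n (C.k₁ * C.ρcyl) * besselJ' n (C.k₂ * C.ρcyl)
      - C.Z₂ * besselJ' n (C.k₁ * C.ρcyl) * besselJ n (C.k₂ * C.ρcyl) = 0 := by
    have h1 := congrArg Complex.re h
    have hJ' : (hankel2' n (C.k₁ * C.ρcyl)).re = besselJ' n (C.k₁ * C.ρcyl) := by
      rw [hankel2'_eq n hx₁, besselJ'_eq n hx₁, ← re_hankel2, ← re_hankel2, ← Complex.sub_re,
        show (2 : ℂ) = ((2 : ℝ) : ℂ) by norm_num, Complex.div_ofReal_re]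
    rw [denom, Complex.sub_re, Complex.re_mul_ofReal, Complex.re_ofReal_mul, Complex.re_mul_ofReal,
      Complex.re_ofReal_mul, re_hankel2, hJ', Complex.zero_re] at h1
    exact_mod_cast h1
  rw [denom] at h
  have h1 : (C.Z₂ : ℂ) * besselJ n (C.k₂ * C.ρcyl) * w = 0 := by
    rw [← hW]
    linear_combination hankel2 n (C.k₁ * C.ρcyl) * hre - (besselJ n (C.k₁ * C.ρcyl) : ℂ) * h
  have h2 : (C.Z₁ : ℂ) * besselJ' n (C.k₂ * C.ρcyl) * w = 0 := by
    rw [← hW]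
    linear_combination hankel2' n (C.k₁ * C.ρcyl) * hre - (besselJ' n (C.k₁ * C.ρcyl) : ℂ) * h
  have h3 : (besselJ n (C.k₂ * C.ρcyl) : ℂ) = 0 := by simpa [hZ₂, hne] using h1
  have h4 : (besselJ' n (C.k₂ * C.ρcyl) : ℂ) = 0 := by simpa [hZ₁, hne] using h2
  rcases besselJ_ne_zero_or n hx₂ with h5 | h5
  · exact h5 (by exact_mod_cast h3)
  · exact h5 (by exact_mod_cast h4)

theorem denom_neg (n : ℤ) : C.denom (-n) = C.denom n := by
  rw [denom, denom, hankel2_neg, hankel2'_neg, besselJ_neg, besselJ'_neg]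
  push_cast
  linear_combination (C.Z₁ * hankel2 n (C.k₁ * C.ρcyl) * besselJ' n (C.k₂ * C.ρcyl)
    - C.Z₂ * hankel2' n (C.k₁ * C.ρcyl) * besselJ n (C.k₂ * C.ρcyl)) * neg_one_zpow_mul_self n

theorem extJ_neg (ρfil : ℝ) (n : ℤ) : C.extJ ρfil (-n) = C.extJ ρfil n := by
  rw [extJ, extJ, denom_neg, hankel2_neg, besselJ'_neg]
  congr 1
  push_cast
  linear_combination (C.Z₁ * hankel2 n (C.k₁ * ρfil) * besselJ' n (C.k₂ * C.ρcyl))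
    * neg_one_zpow_mul_self n

theorem extM_neg (ρfil : ℝ) (n : ℤ) : C.extM ρfil (-n) = C.extM ρfil n := by
  rw [extM, extM, denom_neg, hankel2_neg, besselJ_neg]
  congr 1
  push_cast
  linear_combination (Complex.I * C.Z₁ * C.Z₂ * hankel2 n (C.k₁ * ρfil)
    * besselJ n (C.k₂ * C.ρcyl)) * neg_one_zpow_mul_self n

theorem intJ_neg (ρfil : ℝ) (n : ℤ) : C.intJ ρfil (-n) = C.intJ ρfil n := by
  rw [intJ, intJ, denom_neg, hankel2'_neg, besselJ_neg]
  congr 1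
  push_cast
  linear_combination (C.Z₂ * besselJ n (C.k₂ * ρfil) * hankel2' n (C.k₁ * C.ρcyl))
    * neg_one_zpow_mul_self n

theorem intM_neg (ρfil : ℝ) (n : ℤ) : C.intM ρfil (-n) = C.intM ρfil n := by
  rw [intM, intM, denom_neg, hankel2_neg, besselJ_neg]
  congr 1
  push_cast
  linear_combination (Complex.I * C.Z₁ * C.Z₂ * besselJ n (C.k₂ * ρfil)
    * hankel2 n (C.k₁ * C.ρcyl)) * neg_one_zpow_mul_self n

/-- The limit of the rescaled denominators, up to the factor `i / π`. -/
noncomputable def denomLimit : ℝ := C.Z₁ / (C.k₂ * C.ρcyl) + C.Z₂ / (C.k₁ * C.ρcyl)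

theorem denomLimit_pos : 0 < C.denomLimit :=
  add_pos (div_pos C.Z₁_pos (mul_pos C.k₂_pos C.ρcyl_pos))
    (div_pos C.Z₂_pos (mul_pos C.k₁_pos C.ρcyl_pos))

theorem I_div_pi_ne_zero : (Complex.I / π : ℂ) ≠ 0 :=
  div_ne_zero Complex.I_ne_zero (by exact_mod_cast Real.pi_ne_zero)

theorem tendsto_denom :
    Tendsto (fun n : ℕ => C.denom (n + 1) * (((C.k₁ * C.ρcyl : ℝ) / 2 : ℂ) ^ (n + 1)
      / ((C.k₂ * C.ρcyl : ℝ) / 2 : ℂ) ^ (n + 1))) atTop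
      (𝓝 (Complex.I / π * C.denomLimit)) := by
  have hx₁ := mul_pos C.k₁_pos C.ρcyl_pos
  have hx₂ := mul_pos C.k₂_pos C.ρcyl_pos
  have h := (((tendsto_hankel2_succ hx₁).mul (tendsto_ofReal_besselJ'_succ hx₂)).const_mul
    (C.Z₁ : ℂ)).sub (((tendsto_hankel2'_succ hx₁).mul (tendsto_ofReal_besselJ_succ hx₂)).const_mul
    (C.Z₂ : ℂ))
  have e : (C.Z₁ : ℂ) * (Complex.I / π * (1 / (C.k₂ * C.ρcyl : ℝ)))
      - C.Z₂ * (-(Complex.I / π) / (C.k₁ * C.ρcyl : ℝ) * 1) = Complex.I / π * C.denomLimit := by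
    rw [denomLimit]; push_cast; ring
  rw [e] at h
  refine h.congr fun n => ?_
  have hf : (n.factorial : ℂ) ≠ 0 := by exact_mod_cast n.factorial_ne_zero
  have hf' : ((n + 1).factorial : ℂ) ≠ 0 := by exact_mod_cast (n + 1).factorial_ne_zero
  rw [denom]
  field_simp

theorem denomLimit_ne_zero : (Complex.I / π * C.denomLimit : ℂ) ≠ 0 :=
  mul_ne_zero I_div_pi_ne_zero (by exact_mod_cast C.denomLimit_pos.ne')

theorem half_pow_ne_zero {x : ℝ} (hx : 0 < x) (n : ℕ) : ((x : ℂ) / 2) ^ n ≠ 0 :=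
  pow_ne_zero _ (div_ne_zero (by exact_mod_cast hx.ne') two_ne_zero)

/-- The geometric factors in terms of the arguments of the Bessel functions. -/
theorem ofReal_div_pow {k : ℝ} (hk : 0 < k) (a b : ℝ) (n : ℕ) :
    (((a / b) ^ n : ℝ) : ℂ) = ((k * a : ℝ) / 2 : ℂ) ^ n / ((k * b : ℝ) / 2 : ℂ) ^ n := by
  have hk' : (k : ℂ) ≠ 0 := by exact_mod_cast hk.ne'
  rw [← div_pow]
  push_cast
  congr 1
  rw [div_div_div_cancel_right₀ two_ne_zero, mul_div_mul_left _ _ hk']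

theorem extJ_const_eq : C.Z₁ / (C.Z₁ + C.Z₂ * C.k₂ / C.k₁)
    = C.Z₁ / (C.k₂ * C.ρcyl) / C.denomLimit := by
  have := C.k₁_pos; have := C.k₂_pos; have := C.Z₁_pos; have := C.Z₂_pos; have := C.ρcyl_pos
  rw [denomLimit]
  field_simp

theorem intJ_const_eq : C.Z₂ / (C.Z₂ + C.Z₁ * C.k₁ / C.k₂)
    = C.Z₂ / (C.k₁ * C.ρcyl) / C.denomLimit := by
  have := C.k₁_pos; have := C.k₂_pos; have := C.Z₁_pos; have := C.Z₂_pos; have := C.ρcyl_pos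
  rw [denomLimit]
  field_simp
  ring

theorem M_const_eq : C.Z₁ * C.Z₂ / (C.Z₁ / C.k₂ + C.Z₂ / C.k₁) * C.ρcyl
    = C.Z₁ * C.Z₂ / C.denomLimit := by
  have := C.k₁_pos; have := C.k₂_pos; have := C.Z₁_pos; have := C.Z₂_pos; have := C.ρcyl_pos
  rw [denomLimit]
  field_simp

variable {C} {ρfil : ℝ}

theorem extJ_isEquivalent (h : C.ρcyl < ρfil) :
    (fun n : ℤ => C.extJ ρfil n) ~[cofinite]
      (fun n : ℤ => ((C.Z₁ / (C.Z₁ + C.Z₂ * C.k₂ / C.k₁)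
        * (C.ρcyl / ρfil) ^ n.natAbs : ℝ) : ℂ)) := by
  have hρ := C.ρcyl_pos
  have hρf : 0 < ρfil := hρ.trans h
  have hx₁ := mul_pos C.k₁_pos hρ
  have hx₂ := mul_pos C.k₂_pos hρ
  have hxf := mul_pos C.k₁_pos hρf
  have hκ : 0 < C.Z₁ / (C.k₂ * C.ρcyl) / C.denomLimit :=
    div_pos (div_pos C.Z₁_pos hx₂) C.denomLimit_pos
  rw [extJ_const_eq]
  set κ := C.Z₁ / (C.k₂ * C.ρcyl) / C.denomLimit with hκdef
  have hκ' : (κ : ℂ) ≠ 0 := by exact_mod_cast hκ.ne'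
  refine isEquivalent_cofinite_of_tendsto_div (C.extJ_neg ρfil) (fun n => by simp) ?_
  have hlim := ((((tendsto_hankel2_succ hxf).mul (tendsto_ofReal_besselJ'_succ hx₂)).const_mul
    (C.Z₁ : ℂ)).div C.tendsto_denom C.denomLimit_ne_zero).div_const (κ : ℂ)
  have e : (C.Z₁ : ℂ) * (Complex.I / π * (1 / (C.k₂ * C.ρcyl : ℝ)))
      / (Complex.I / π * C.denomLimit) / κ = 1 := by
    have e1 : (C.Z₁ : ℂ) * (Complex.I / π * (1 / (C.k₂ * C.ρcyl : ℝ)))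
      = Complex.I / π * (C.Z₁ / (C.k₂ * C.ρcyl) : ℝ) := by push_cast; ring
    rw [e1, mul_div_mul_left _ _ I_div_pi_ne_zero, ← Complex.ofReal_div, div_self hκ']
  rw [e] at hlim
  refine hlim.congr fun n => ?_
  have hf : (n.factorial : ℂ) ≠ 0 := by exact_mod_cast n.factorial_ne_zero
  have hd := C.denom_ne_zero (n + 1)
  have p₁ := half_pow_ne_zero hx₁ (n + 1)
  have p₂ := half_pow_ne_zero hx₂ (n + 1)
  have pf := half_pow_ne_zero hxf (n + 1)
  have hn : ((n : ℤ) + 1).natAbs = n + 1 := by omega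
  simp only [Pi.div_apply]
  rw [hn, Complex.ofReal_mul κ, ofReal_div_pow C.k₁_pos, extJ]
  field_simp

theorem extM_isEquivalent (h : C.ρcyl < ρfil) :
    (fun n : ℤ => C.extM ρfil n) ~[cofinite]
      (fun n : ℤ => Complex.I * ((C.Z₁ * C.Z₂ / (C.Z₁ / C.k₂ + C.Z₂ / C.k₁)
        * (C.ρcyl / n.natAbs) * (C.ρcyl / ρfil) ^ n.natAbs : ℝ) : ℂ)) := by
  have hρ := C.ρcyl_pos
  have hρf : 0 < ρfil := hρ.trans h
  have hx₁ := mul_pos C.k₁_pos hρ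
  have hx₂ := mul_pos C.k₂_pos hρ
  have hxf := mul_pos C.k₁_pos hρf
  have hκ : 0 < C.Z₁ * C.Z₂ / C.denomLimit :=
    div_pos (mul_pos C.Z₁_pos C.Z₂_pos) C.denomLimit_pos
  simp only [← mul_div_assoc, M_const_eq]
  set κ := C.Z₁ * C.Z₂ / C.denomLimit with hκdef
  have hκ' : (κ : ℂ) ≠ 0 := by exact_mod_cast hκ.ne'
  have hI := Complex.I_ne_zero
  refine isEquivalent_cofinite_of_tendsto_div (C.extM_neg ρfil) (fun n => by simp) ?_
  have hlim := ((((tendsto_hankel2_succ hxf).mul (tendsto_ofReal_besselJ_succ hx₂)).const_mul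
    (Complex.I * C.Z₁ * C.Z₂ : ℂ)).div C.tendsto_denom C.denomLimit_ne_zero).div_const
    (Complex.I * κ : ℂ)
  have e : (Complex.I * C.Z₁ * C.Z₂ : ℂ) * (Complex.I / π * 1)
      / (Complex.I / π * C.denomLimit) / (Complex.I * κ) = 1 := by
    have e1 : (Complex.I * C.Z₁ * C.Z₂ : ℂ) * (Complex.I / π * 1)
      = Complex.I / π * (Complex.I * (C.Z₁ * C.Z₂ : ℝ)) := by push_cast; ring
    rw [e1, mul_div_mul_left _ _ I_div_pi_ne_zero, mul_div_assoc, ← Complex.ofReal_div,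
      div_self (mul_ne_zero hI hκ')]
  rw [e] at hlim
  refine hlim.congr fun n => ?_
  have hf : (n.factorial : ℂ) ≠ 0 := by exact_mod_cast n.factorial_ne_zero
  have hn0 : (n : ℂ) + 1 ≠ 0 := by exact_mod_cast n.succ_ne_zero
  have hd := C.denom_ne_zero (n + 1)
  have p₁ := half_pow_ne_zero hx₁ (n + 1)
  have p₂ := half_pow_ne_zero hx₂ (n + 1)
  have pf := half_pow_ne_zero hxf (n + 1)
  have hn : ((n : ℤ) + 1).natAbs = n + 1 := by omega
  simp only [Pi.div_apply]
  rw [hn, Complex.ofReal_mul (κ / _), Complex.ofReal_div κ, ofReal_div_pow C.k₁_pos, extM,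
    Nat.factorial_succ]
  push_cast at hd p₁ p₂ pf ⊢
  field_simp

theorem intJ_isEquivalent (h0 : 0 ≤ ρfil) :
    (fun n : ℤ => C.intJ ρfil n) ~[cofinite]
      (fun n : ℤ => ((C.Z₂ / (C.Z₂ + C.Z₁ * C.k₁ / C.k₂)
        * (ρfil / C.ρcyl) ^ n.natAbs : ℝ) : ℂ)) := by
  have hρ := C.ρcyl_pos
  have hx₁ := mul_pos C.k₁_pos hρ
  have hx₂ := mul_pos C.k₂_pos hρ
  rcases h0.eq_or_lt with rfl | hρf
  · -- a filament on the axis excites only the mode `n = 0`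
    refine IsEquivalent.congr_left IsEquivalent.refl ?_
    filter_upwards [(Set.finite_singleton (0 : ℤ)).compl_mem_cofinite] with n hn
    have hn' : n ≠ 0 := hn
    simp [intJ, besselJ_zero_right, hn']
  have hxf := mul_pos C.k₂_pos hρf
  have hκ : 0 < C.Z₂ / (C.k₁ * C.ρcyl) / C.denomLimit :=
    div_pos (div_pos C.Z₂_pos hx₁) C.denomLimit_pos
  rw [intJ_const_eq]
  set κ := C.Z₂ / (C.k₁ * C.ρcyl) / C.denomLimit with hκdef
  have hκ' : (κ : ℂ) ≠ 0 := by exact_mod_cast hκ.ne'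
  refine isEquivalent_cofinite_of_tendsto_div (C.intJ_neg ρfil) (fun n => by simp) ?_
  have hlim := ((((tendsto_ofReal_besselJ_succ hxf).mul (tendsto_hankel2'_succ hx₁)).const_mul
    (-C.Z₂ : ℂ)).div C.tendsto_denom C.denomLimit_ne_zero).div_const (κ : ℂ)
  have e : (-C.Z₂ : ℂ) * (1 * (-(Complex.I / π) / (C.k₁ * C.ρcyl : ℝ)))
      / (Complex.I / π * C.denomLimit) / κ = 1 := by
    have e1 : (-C.Z₂ : ℂ) * (1 * (-(Complex.I / π) / (C.k₁ * C.ρcyl : ℝ)))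
      = Complex.I / π * (C.Z₂ / (C.k₁ * C.ρcyl) : ℝ) := by push_cast; ring
    rw [e1, mul_div_mul_left _ _ I_div_pi_ne_zero, ← Complex.ofReal_div, div_self hκ']
  rw [e] at hlim
  refine hlim.congr fun n => ?_
  have hf : ((n + 1).factorial : ℂ) ≠ 0 := by exact_mod_cast (n + 1).factorial_ne_zero
  have hd := C.denom_ne_zero (n + 1)
  have p₁ := half_pow_ne_zero hx₁ (n + 1)
  have p₂ := half_pow_ne_zero hx₂ (n + 1)
  have pf := half_pow_ne_zero hxf (n + 1)
  have hn : ((n : ℤ) + 1).natAbs = n + 1 := by omega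
  simp only [Pi.div_apply]
  rw [hn, Complex.ofReal_mul κ, ofReal_div_pow C.k₂_pos, intJ]
  field_simp

theorem intM_isEquivalent (h0 : 0 ≤ ρfil) :
    (fun n : ℤ => C.intM ρfil n) ~[cofinite]
      (fun n : ℤ => -Complex.I * ((C.Z₁ * C.Z₂ / (C.Z₁ / C.k₂ + C.Z₂ / C.k₁)
        * (C.ρcyl / n.natAbs) * (ρfil / C.ρcyl) ^ n.natAbs : ℝ) : ℂ)) := by
  have hρ := C.ρcyl_pos
  have hx₁ := mul_pos C.k₁_pos hρ
  have hx₂ := mul_pos C.k₂_pos hρ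
  rcases h0.eq_or_lt with rfl | hρf
  · -- a filament on the axis excites only the mode `n = 0`
    refine IsEquivalent.congr_left IsEquivalent.refl ?_
    filter_upwards [(Set.finite_singleton (0 : ℤ)).compl_mem_cofinite] with n hn
    have hn' : n ≠ 0 := hn
    simp [intM, besselJ_zero_right, hn']
  have hxf := mul_pos C.k₂_pos hρf
  have hκ : 0 < C.Z₁ * C.Z₂ / C.denomLimit :=
    div_pos (mul_pos C.Z₁_pos C.Z₂_pos) C.denomLimit_pos
  simp only [← mul_div_assoc, M_const_eq]
  set κ := C.Z₁ * C.Z₂ / C.denomLimit with hκdef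
  have hκ' : (κ : ℂ) ≠ 0 := by exact_mod_cast hκ.ne'
  have hI := Complex.I_ne_zero
  refine isEquivalent_cofinite_of_tendsto_div (C.intM_neg ρfil) (fun n => by simp) ?_
  have hlim := ((((tendsto_ofReal_besselJ_succ hxf).mul (tendsto_hankel2_succ hx₁)).const_mul
    (Complex.I * C.Z₁ * C.Z₂ : ℂ)).div C.tendsto_denom C.denomLimit_ne_zero).div_const
    (Complex.I * κ : ℂ)
  have e : (Complex.I * C.Z₁ * C.Z₂ : ℂ) * (1 * (Complex.I / π))
      / (Complex.I / π * C.denomLimit) / (Complex.I * κ) = 1 := by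
    have e1 : (Complex.I * C.Z₁ * C.Z₂ : ℂ) * (1 * (Complex.I / π))
      = Complex.I / π * (Complex.I * (C.Z₁ * C.Z₂ : ℝ)) := by push_cast; ring
    rw [e1, mul_div_mul_left _ _ I_div_pi_ne_zero, mul_div_assoc, ← Complex.ofReal_div,
      div_self (mul_ne_zero hI hκ')]
  rw [e] at hlim
  refine hlim.congr fun n => ?_
  have hf : (n.factorial : ℂ) ≠ 0 := by exact_mod_cast n.factorial_ne_zero
  have hn0 : (n : ℂ) + 1 ≠ 0 := by exact_mod_cast n.succ_ne_zero
  have hd := C.denom_ne_zero (n + 1)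
  have p₁ := half_pow_ne_zero hx₁ (n + 1)
  have p₂ := half_pow_ne_zero hx₂ (n + 1)
  have pf := half_pow_ne_zero hxf (n + 1)
  have hn : ((n : ℤ) + 1).natAbs = n + 1 := by omega
  simp only [Pi.div_apply]
  rw [hn, Complex.ofReal_mul (κ / _), Complex.ofReal_div κ, ofReal_div_pow C.k₂_pos, intM,
    Nat.factorial_succ]
  push_cast at hd p₁ p₂ pf ⊢
  field_simp

theorem norm_M_bound (C : Cylinder) {r : ℝ} (hr : 0 ≤ r) (n : ℤ) :
    |C.Z₁ * C.Z₂ / (C.Z₁ / C.k₂ + C.Z₂ / C.k₁) * (C.ρcyl / n.natAbs) * r ^ n.natAbs|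
      ≤ C.Z₁ * C.Z₂ / (C.Z₁ / C.k₂ + C.Z₂ / C.k₁) * C.ρcyl * r ^ n.natAbs := by
  have := C.k₁_pos; have := C.k₂_pos; have := C.Z₁_pos; have := C.Z₂_pos; have := C.ρcyl_pos
  rw [abs_of_nonneg (by positivity)]
  gcongr
  rcases Nat.eq_zero_or_pos n.natAbs with h | h
  · -- for `n = 0` the left side is zero, by the convention for division by zero
    simp [h]; positivity
  · exact div_le_self C.ρcyl_pos.le (by exact_mod_cast h)

theorem summable_extJ (h : C.ρcyl < ρfil) : Summable fun n : ℤ => ‖C.extJ ρfil n‖ := by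
  have hρf : 0 < ρfil := C.ρcyl_pos.trans h
  have hr : 0 ≤ C.ρcyl / ρfil := (div_pos C.ρcyl_pos hρf).le
  refine summable_norm_of_isEquivalent
    (B := ‖C.Z₁ / (C.Z₁ + C.Z₂ * C.k₂ / C.k₁)‖)
    hr ((div_lt_one hρf).2 h) (extJ_isEquivalent h) fun n => ?_
  rw [Complex.norm_real, norm_mul, norm_pow, Real.norm_of_nonneg hr]

theorem summable_extM (h : C.ρcyl < ρfil) : Summable fun n : ℤ => ‖C.extM ρfil n‖ := by
  have hρf : 0 < ρfil := C.ρcyl_pos.trans h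
  have hr : 0 ≤ C.ρcyl / ρfil := (div_pos C.ρcyl_pos hρf).le
  refine summable_norm_of_isEquivalent
    (B := C.Z₁ * C.Z₂ / (C.Z₁ / C.k₂ + C.Z₂ / C.k₁) * C.ρcyl)
    hr ((div_lt_one hρf).2 h) (extM_isEquivalent h) fun n => ?_
  rw [norm_mul, Complex.norm_I, one_mul, Complex.norm_real, Real.norm_eq_abs]
  exact norm_M_bound C hr n

theorem summable_intJ (h0 : 0 ≤ ρfil) (h : ρfil < C.ρcyl) :
    Summable fun n : ℤ => ‖C.intJ ρfil n‖ := by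
  have hr : 0 ≤ ρfil / C.ρcyl := div_nonneg h0 C.ρcyl_pos.le
  refine summable_norm_of_isEquivalent
    (B := ‖C.Z₂ / (C.Z₂ + C.Z₁ * C.k₁ / C.k₂)‖)
    hr ((div_lt_one C.ρcyl_pos).2 h) (intJ_isEquivalent h0)
    fun n => ?_
  rw [Complex.norm_real, norm_mul, norm_pow, Real.norm_of_nonneg hr]

theorem summable_intM (h0 : 0 ≤ ρfil) (h : ρfil < C.ρcyl) :
    Summable fun n : ℤ => ‖C.intM ρfil n‖ := by
  have hr : 0 ≤ ρfil / C.ρcyl := div_nonneg h0 C.ρcyl_pos.le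
  refine summable_norm_of_isEquivalent
    (B := C.Z₁ * C.Z₂ / (C.Z₁ / C.k₂ + C.Z₂ / C.k₁) * C.ρcyl)
    hr ((div_lt_one C.ρcyl_pos).2 h) (intM_isEquivalent h0)
    fun n => ?_
  rw [norm_mul, norm_neg, Complex.norm_I, one_mul, Complex.norm_real, Real.norm_eq_abs]
  exact norm_M_bound C hr n

end Cylinder

/-! ### The integral equations in terms of Fourier coefficients -/

theorem incidentField_eq {k : ℝ} (hk : 0 ≤ k) (Z : ℝ) (I₀ : ℂ) (ρfil ρ φ : ℝ) :
    incidentField k Z I₀ ρfil ρ φ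
      = -((k * Z / 4 : ℝ) : ℂ) * I₀ * electricKernel (k * ρ) (k * ρfil) φ := by
  rw [incidentField, electricKernel, dist2_mul hk]

theorem radiatedField_eq {k : ℝ} (hk : 0 < k) (Z ρcyl : ℝ) (J M : ℝ → ℂ) (ρ φ : ℝ) :
    radiatedField k Z ρcyl J M ρ φ
      = -((k * Z * ρcyl / 4 : ℝ) : ℂ) * kernelIntegral J (electricKernel (k * ρcyl) (k * ρ)) φ
        + ((k * ρcyl : ℝ) : ℂ) / (4 * Complex.I)
          * kernelIntegral M (magneticKernel (k * ρcyl) (k * ρ)) φ := by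
  rw [radiatedField, kernelIntegral, kernelIntegral]
  congr 2
  · simp only [electricKernel, dist2_mul hk.le]
  · refine intervalIntegral.integral_congr fun t _ => ?_
    simp only [magneticKernel, dist2_mul hk.le]
    rw [mul_assoc (M t), mul_assoc k ρ, ← mul_sub, mul_div_mul_left _ _ hk.ne']

/-- A sum of a continuous field and of radiated fields vanishes identically if and only if all its
Fourier coefficients vanish. -/
theorem forall_field_eq_zero_iff {g J M K L : ℝ → ℂ} (c d : ℂ) (hg : Continuous g)
    (hgp : Function.Periodic g (2 * π)) (hJ : IntervalIntegrable J volume (-π) π)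
    (hM : IntervalIntegrable M volume (-π) π) (hK : Continuous K)
    (hKp : Function.Periodic K (2 * π)) (hL : Continuous L) (hLp : Function.Periodic L (2 * π)) :
    (∀ φ, g φ + (c * kernelIntegral J K φ + d * kernelIntegral M L φ) = 0) ↔
      ∀ n, fourierInt g n + (c * (fourierInt J n * fourierInt K (-n))
        + d * (fourierInt M n * fourierInt L (-n))) = 0 := by
  have cJ := continuous_kernelIntegral hJ hK hKp
  have cM := continuous_kernelIntegral hM hL hLp
  have hcoef : ∀ n, fourierInt (fun φ => g φ + (c * kernelIntegral J K φ
      + d * kernelIntegral M L φ)) n = fourierInt g n + (c * (fourierInt J n * fourierInt K (-n))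
        + d * (fourierInt M n * fourierInt L (-n))) := fun n => by
    rw [fourierInt_add (hg.intervalIntegrable _ _)
      (Continuous.intervalIntegrable (by fun_prop) _ _),
      fourierInt_add (Continuous.intervalIntegrable (by fun_prop) _ _)
      (Continuous.intervalIntegrable (by fun_prop) _ _), fourierInt_const_mul,
      fourierInt_const_mul, fourierInt_kernelIntegral hJ hK hKp,
      fourierInt_kernelIntegral hM hL hLp]
  constructor
  · intro h n
    rw [← hcoef]
    simp [h, fourierInt]
  · intro h
    refine eq_zero_of_fourierInt_eq_zero (by fun_prop) (fun φ => ?_) fun n => (hcoef n).trans (h n)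
    rw [hgp, kernelIntegral_periodic J hKp, kernelIntegral_periodic M hLp]

namespace Cylinder

variable (C : Cylinder)

/-- The `n`-th Fourier mode of the total field of the first equivalent problem on a circle inside
the cylinder, up to a factor that contains the radius of that circle. Here `s` stands for the
filament and `p`, `q` for the Fourier coefficients of the densities. -/
noncomputable def innerMode (n : ℤ) (s p q : ℂ) : ℂ :=
  s + C.ρcyl * (C.Z₁ * p * hankel2 n (C.k₁ * C.ρcyl)
    - Complex.I * q * hankel2' n (C.k₁ * C.ρcyl))

/-- The `n`-th Fourier mode of the total field of the second equivalent problem on a circle outside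
the cylinder, up to a nonzero factor. -/
noncomputable def outerMode (n : ℤ) (s p q : ℂ) : ℂ :=
  s - C.ρcyl * (C.Z₂ * p * besselJ n (C.k₂ * C.ρcyl)
    - Complex.I * q * besselJ' n (C.k₂ * C.ρcyl))

variable {C}

theorem fourierInt_electricKernel_neg (n : ℤ) {a b : ℝ} (ha : 0 ≤ a) (hab : a < b) :
    fourierInt (electricKernel a b) (-n) = 2 * π * (besselJ n a * hankel2 n b) := by
  rw [fourierInt_electricKernel _ ha hab, besselJ_neg, hankel2_neg]
  push_cast
  linear_combination 2 * π * (besselJ n a * hankel2 n b) * neg_one_zpow_mul_self n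

/-- The field of the densities in medium 1, together with a given field `g`, vanishes on a circle
inside the cylinder if and only if all modes with `J_n(k₁ρ) ≠ 0` do. -/
theorem field_eq_zero_iff_innerMode {g J M : ℝ → ℂ} {s : ℤ → ℂ} {ρ : ℝ} (hρ : 0 < ρ)
    (hρc : ρ < C.ρcyl)
    (hg : Continuous g) (hgp : Function.Periodic g (2 * π))
    (hJ : IntervalIntegrable J volume (-π) π) (hM : IntervalIntegrable M volume (-π) π)
    (hs : ∀ n, fourierInt g n = -(π * C.k₁ / 2) * besselJ n (C.k₁ * ρ) * s n) :
    (∀ φ, g φ + radiatedField C.k₁ C.Z₁ C.ρcyl J M ρ φ = 0) ↔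
      ∀ n, besselJ n (C.k₁ * ρ) * C.innerMode n (s n) (fourierInt J n) (fourierInt M n)
        = (0 : ℂ) := by
  have hk := C.k₁_pos
  have hk' : (C.k₁ : ℂ) ≠ 0 := by exact_mod_cast hk.ne'
  have hpi : (π : ℂ) ≠ 0 := by exact_mod_cast Real.pi_ne_zero
  have h1 : 0 < C.k₁ * ρ := mul_pos hk hρ
  have h2 : 0 < C.k₁ * C.ρcyl := mul_pos hk C.ρcyl_pos
  have h3 : C.k₁ * ρ < C.k₁ * C.ρcyl := by gcongr
  simp only [radiatedField_eq hk]
  rw [forall_field_eq_zero_iff _ _ hg hgp hJ hM (continuous_electricKernel h2.le h1.le h3.ne')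
    (electricKernel_periodic _ _) (continuous_magneticKernel h2.le h1.le h3.ne')
    (magneticKernel_periodic _ _)]
  refine forall_congr' fun n => ?_
  have hne : (-(π * C.k₁ / 2) : ℂ) ≠ 0 :=
    neg_ne_zero.2 (div_ne_zero (mul_ne_zero hpi hk') two_ne_zero)
  refine Iff.trans (Eq.congr_left ?_) (mul_eq_zero_iff_left hne)
  rw [hs, electricKernel_comm, fourierInt_electricKernel_neg n h1.le h3,
    fourierInt_magneticKernel_of_gt _ h1.le h3, besselJ_neg, hankel2'_neg, innerMode,
    div_eq_mul_inv _ (4 * Complex.I), mul_inv, Complex.inv_I]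
  push_cast
  linear_combination ((C.k₁ * C.ρcyl / 4 : ℂ) * Complex.I * fourierInt M n * 2 * π
    * besselJ n (C.k₁ * ρ) * hankel2' n (C.k₁ * C.ρcyl)) * neg_one_zpow_mul_self n

/-- The field of the negative densities in medium 2, together with a given field `g`, vanishes on a
circle outside the cylinder if and only if all modes do; here `H_n(k₂ρ) ≠ 0` drops out. -/
theorem field_eq_zero_iff_outerMode {g J M : ℝ → ℂ} {s : ℤ → ℂ} {ρ : ℝ} (hρc : C.ρcyl < ρ)
    (hg : Continuous g) (hgp : Function.Periodic g (2 * π))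
    (hJ : IntervalIntegrable J volume (-π) π) (hM : IntervalIntegrable M volume (-π) π)
    (hs : ∀ n, fourierInt g n = -(π * C.k₂ / 2) * hankel2 n (C.k₂ * ρ) * s n) :
    (∀ φ, g φ + radiatedField C.k₂ C.Z₂ C.ρcyl (fun t => -J t) (fun t => -M t) ρ φ = 0) ↔
      ∀ n, C.outerMode n (s n) (fourierInt J n) (fourierInt M n) = 0 := by
  have hk := C.k₂_pos
  have hk' : (C.k₂ : ℂ) ≠ 0 := by exact_mod_cast hk.ne'
  have hpi : (π : ℂ) ≠ 0 := by exact_mod_cast Real.pi_ne_zero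
  have hJ' : IntervalIntegrable (fun t => -J t) volume (-π) π := hJ.neg
  have hM' : IntervalIntegrable (fun t => -M t) volume (-π) π := hM.neg
  have h1 : 0 < C.k₂ * ρ := mul_pos hk (C.ρcyl_pos.trans hρc)
  have h2 : 0 < C.k₂ * C.ρcyl := mul_pos hk C.ρcyl_pos
  have h3 : C.k₂ * C.ρcyl < C.k₂ * ρ := by gcongr
  simp only [radiatedField_eq hk]
  rw [forall_field_eq_zero_iff _ _ hg hgp hJ' hM'
    (continuous_electricKernel h2.le h1.le h3.ne) (electricKernel_periodic _ _)
    (continuous_magneticKernel h2.le h1.le h3.ne) (magneticKernel_periodic _ _)]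
  refine forall_congr' fun n => ?_
  have hne : (-(π * C.k₂ / 2) * hankel2 n (C.k₂ * ρ) : ℂ) ≠ 0 :=
    mul_ne_zero (neg_ne_zero.2 (div_ne_zero (mul_ne_zero hpi hk') two_ne_zero))
      (hankel2_ne_zero n h1)
  refine Iff.trans (Eq.congr_left ?_) (mul_eq_zero_iff_left hne)
  rw [hs, fourierInt_electricKernel_neg n h2.le h3, fourierInt_magneticKernel_of_lt _ h2 h3,
    besselJ'_neg, hankel2_neg, fourierInt_neg, fourierInt_neg, outerMode,
    div_eq_mul_inv _ (4 * Complex.I), mul_inv, Complex.inv_I]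
  push_cast
  linear_combination (-(C.k₂ * C.ρcyl / 4 : ℂ) * Complex.I * fourierInt M n * 2 * π
    * besselJ' n (C.k₂ * C.ρcyl) * hankel2 n (C.k₂ * ρ)) * neg_one_zpow_mul_self n

theorem fourierInt_incidentField_of_lt {k : ℝ} (hk : 0 < k) (Z : ℝ) (I₀ : ℂ) {ρfil ρ : ℝ}
    (hρ : 0 ≤ ρ) (h : ρ < ρfil) (n : ℤ) :
    fourierInt (incidentField k Z I₀ ρfil ρ) n
      = -(π * k / 2) * besselJ n (k * ρ) * (Z * I₀ * hankel2 n (k * ρfil)) := by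
  rw [funext (incidentField_eq hk.le Z I₀ ρfil ρ), fourierInt_const_mul,
    fourierInt_electricKernel n (mul_nonneg hk.le hρ) (by gcongr)]
  push_cast; ring

theorem fourierInt_incidentField_of_gt {k : ℝ} (hk : 0 < k) (Z : ℝ) (I₀ : ℂ) {ρfil ρ : ℝ}
    (hρ : 0 ≤ ρfil) (h : ρfil < ρ) (n : ℤ) :
    fourierInt (incidentField k Z I₀ ρfil ρ) n
      = -(π * k / 2) * hankel2 n (k * ρ) * (Z * I₀ * besselJ n (k * ρfil)) := by
  rw [funext (incidentField_eq hk.le Z I₀ ρfil ρ), fourierInt_const_mul, electricKernel_comm,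
    fourierInt_electricKernel n (mul_nonneg hk.le hρ) (by gcongr)]
  push_cast; ring

theorem continuous_incidentField {k : ℝ} (hk : 0 < k) (Z : ℝ) (I₀ : ℂ) {ρfil ρ : ℝ}
    (h0 : 0 ≤ ρfil) (hρ : 0 ≤ ρ) (h : ρ ≠ ρfil) : Continuous (incidentField k Z I₀ ρfil ρ) := by
  rw [funext (incidentField_eq hk.le Z I₀ ρfil ρ)]
  exact continuous_const.mul (continuous_electricKernel (mul_nonneg hk.le hρ)
    (mul_nonneg hk.le h0) fun h' => h (mul_left_cancel₀ hk.ne' h'))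

theorem incidentField_periodic {k : ℝ} (hk : 0 < k) (Z : ℝ) (I₀ : ℂ) (ρfil ρ : ℝ) :
    Function.Periodic (incidentField k Z I₀ ρfil ρ) (2 * π) := fun φ => by
  rw [incidentField_eq hk.le, incidentField_eq hk.le, electricKernel_periodic]

/-- The system of integral equations, mode by mode; `s` and `t` are the modes of the filament in the
first and in the second equivalent problem, up to the factors of `innerMode` and `outerMode`. The
factor `J_n(k₁ρ₁)` is the only trace of the auxiliary radii. -/
def SolvesModes (C : Cylinder) (ρ₁ : ℝ) (s t : ℤ → ℂ) (J M : ℝ → ℂ) : Prop :=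
  IntervalIntegrable J volume (-π) π ∧ IntervalIntegrable M volume (-π) π ∧
    (∀ n, besselJ n (C.k₁ * ρ₁) * C.innerMode n (s n) (fourierInt J n) (fourierInt M n) = (0 : ℂ)) ∧
    ∀ n, C.outerMode n (t n) (fourierInt J n) (fourierInt M n) = 0

theorem solvesExternal_iff {I₀ : ℂ} {ρfil ρ₁ ρ₂ : ℝ} (hfil : C.ρcyl < ρfil) (h0 : 0 < ρ₁)
    (h1 : ρ₁ < C.ρcyl) (h2 : C.ρcyl < ρ₂) (J M : ℝ → ℂ) :
    C.SolvesExternal I₀ ρfil ρ₁ ρ₂ J M ↔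
      C.SolvesModes ρ₁ (fun n => C.Z₁ * I₀ * hankel2 n (C.k₁ * ρfil)) (fun _ => 0) J M := by
  have key : ∀ (hJ : IntervalIntegrable J volume (-π) π) (hM : IntervalIntegrable M volume (-π) π),
      _ ∧ _ := fun hJ hM => ⟨field_eq_zero_iff_innerMode (C := C) h0 h1
      (continuous_incidentField C.k₁_pos C.Z₁ I₀ (C.ρcyl_pos.trans hfil).le h0.le
        (h1.trans hfil).ne)
      (incidentField_periodic C.k₁_pos C.Z₁ I₀ ρfil ρ₁) hJ hM
      (fourierInt_incidentField_of_lt C.k₁_pos C.Z₁ I₀ h0.le (h1.trans hfil)),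
    field_eq_zero_iff_outerMode (C := C) (g := fun _ => 0) (s := fun _ => 0) h2
      continuous_const (fun _ => rfl)
      hJ hM (fun n => by simp [fourierInt])⟩
  simp only [zero_add] at key
  exact ⟨fun ⟨hJ, hM, e1, e2⟩ => ⟨hJ, hM, (key hJ hM).1.1 e1, (key hJ hM).2.1 e2⟩,
    fun ⟨hJ, hM, e1, e2⟩ => ⟨hJ, hM, (key hJ hM).1.2 e1, (key hJ hM).2.2 e2⟩⟩

theorem solvesInternal_iff {I₀ : ℂ} {ρfil ρ₁ ρ₂ : ℝ} (hfil0 : 0 ≤ ρfil) (hfil : ρfil < C.ρcyl)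
    (h0 : 0 < ρ₁) (h1 : ρ₁ < C.ρcyl) (h2 : C.ρcyl < ρ₂) (J M : ℝ → ℂ) :
    C.SolvesInternal I₀ ρfil ρ₁ ρ₂ J M ↔
      C.SolvesModes ρ₁ (fun _ => 0) (fun n => C.Z₂ * I₀ * besselJ n (C.k₂ * ρfil)) J M := by
  have key : ∀ (hJ : IntervalIntegrable J volume (-π) π) (hM : IntervalIntegrable M volume (-π) π),
      _ ∧ _ := fun hJ hM => ⟨field_eq_zero_iff_innerMode (C := C) (g := fun _ => 0)
      (s := fun _ => 0) h0 h1
      continuous_const (fun _ => rfl) hJ hM (fun n => by simp [fourierInt]),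
    field_eq_zero_iff_outerMode (C := C) h2
      (continuous_incidentField C.k₂_pos C.Z₂ I₀ hfil0 (C.ρcyl_pos.trans h2).le
        (hfil.trans h2).ne')
      (incidentField_periodic C.k₂_pos C.Z₂ I₀ ρfil ρ₂) hJ hM
      (fourierInt_incidentField_of_gt C.k₂_pos C.Z₂ I₀ hfil0 (hfil.trans h2))⟩
  simp only [zero_add] at key
  exact ⟨fun ⟨hJ, hM, e1, e2⟩ => ⟨hJ, hM, (key hJ hM).1.1 e1, (key hJ hM).2.1 e2⟩,
    fun ⟨hJ, hM, e1, e2⟩ => ⟨hJ, hM, (key hJ hM).1.2 e1, (key hJ hM).2.2 e2⟩⟩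

/-! ### Solution of the modal equations -/

/-- The modal equations have at most one solution, since their determinant is a nonzero multiple of
`Δ_n`. -/
theorem modes_unique {n : ℤ} {s t p q p' q' : ℂ} (h1 : C.innerMode n s p q = 0)
    (h2 : C.outerMode n t p q = 0) (h1' : C.innerMode n s p' q' = 0)
    (h2' : C.outerMode n t p' q' = 0) : p = p' ∧ q = q' := by
  have hΔ := C.denom_ne_zero n
  have hρ : (C.ρcyl : ℂ) ≠ 0 := by exact_mod_cast C.ρcyl_pos.ne'
  rw [innerMode] at h1 h1'
  rw [outerMode] at h2 h2'
  have hp : (C.ρcyl * C.denom n) * (p - p') = 0 := by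
    rw [denom]
    linear_combination (besselJ' n (C.k₂ * C.ρcyl) : ℂ) * (h1 - h1')
      + hankel2' n (C.k₁ * C.ρcyl) * (h2 - h2')
  have hq : (C.ρcyl * Complex.I * C.denom n) * (q - q') = 0 := by
    rw [denom]
    linear_combination (C.Z₂ * besselJ n (C.k₂ * C.ρcyl) : ℂ) * (h1 - h1')
      + C.Z₁ * hankel2 n (C.k₁ * C.ρcyl) * (h2 - h2')
  exact ⟨sub_eq_zero.1 ((mul_eq_zero_iff_left (mul_ne_zero hρ hΔ)).1 hp),
    sub_eq_zero.1 ((mul_eq_zero_iff_left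
      (mul_ne_zero (mul_ne_zero hρ Complex.I_ne_zero) hΔ)).1 hq)⟩

theorem two_pi_mul_amp (C : Cylinder) (I₀ : ℂ) : 2 * π * C.amp I₀ * C.ρcyl = I₀ := by
  have hρ : (C.ρcyl : ℂ) ≠ 0 := by exact_mod_cast C.ρcyl_pos.ne'
  have hpi : (π : ℂ) ≠ 0 := by exact_mod_cast Real.pi_ne_zero
  rw [amp]
  push_cast
  field_simp

/-- The coefficients for external excitation solve the modal equations: Cramer's rule. -/
theorem external_modes (I₀ : ℂ) (ρfil : ℝ) (n : ℤ) :
    C.innerMode n (C.Z₁ * I₀ * hankel2 n (C.k₁ * ρfil)) (2 * π * (-C.amp I₀ * C.extJ ρfil n))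
        (2 * π * (C.amp I₀ * C.extM ρfil n)) = 0 ∧
      C.outerMode n 0 (2 * π * (-C.amp I₀ * C.extJ ρfil n))
        (2 * π * (C.amp I₀ * C.extM ρfil n)) = 0 := by
  have hΔ := C.denom_ne_zero n
  have ha := C.two_pi_mul_amp I₀
  set A := C.amp I₀
  have eJ : C.extJ ρfil n * C.denom n
      = C.Z₁ * hankel2 n (C.k₁ * ρfil) * besselJ' n (C.k₂ * C.ρcyl) := div_mul_cancel₀ _ hΔ
  have eM : C.extM ρfil n * C.denom n = Complex.I * C.Z₁ * C.Z₂ * hankel2 n (C.k₁ * ρfil)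
      * besselJ n (C.k₂ * C.ρcyl) := div_mul_cancel₀ _ hΔ
  have eD : C.denom n = C.Z₁ * hankel2 n (C.k₁ * C.ρcyl) * besselJ' n (C.k₂ * C.ρcyl)
    - C.Z₂ * hankel2' n (C.k₁ * C.ρcyl) * besselJ n (C.k₂ * C.ρcyl) := rfl
  constructor
  · refine (mul_eq_zero_iff_left hΔ).1 ?_
    rw [innerMode, ← ha]
    linear_combination (-(2 * π * A * C.ρcyl) * C.Z₁ * hankel2 n (C.k₁ * C.ρcyl)) * eJ
      - (2 * π * A * C.ρcyl * Complex.I * hankel2' n (C.k₁ * C.ρcyl)) * eM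
      + (2 * π * A * C.ρcyl * C.Z₁ * hankel2 n (C.k₁ * ρfil)) * eD
      - (2 * π * A * C.ρcyl * hankel2' n (C.k₁ * C.ρcyl) * C.Z₁ * C.Z₂ * hankel2 n (C.k₁ * ρfil)
        * besselJ n (C.k₂ * C.ρcyl)) * Complex.I_mul_I
  · refine (mul_eq_zero_iff_left hΔ).1 ?_
    rw [outerMode]
    linear_combination (2 * π * A * C.ρcyl * C.Z₂ * besselJ n (C.k₂ * C.ρcyl)) * eJ
      + (2 * π * A * C.ρcyl * Complex.I * besselJ' n (C.k₂ * C.ρcyl)) * eM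
      + (2 * π * A * C.ρcyl * besselJ' n (C.k₂ * C.ρcyl) * C.Z₁ * C.Z₂ * hankel2 n (C.k₁ * ρfil)
        * besselJ n (C.k₂ * C.ρcyl)) * Complex.I_mul_I

/-- The coefficients for internal excitation solve the modal equations: Cramer's rule. -/
theorem internal_modes (I₀ : ℂ) (ρfil : ℝ) (n : ℤ) :
    C.innerMode n 0 (2 * π * (C.amp I₀ * C.intJ ρfil n)) (2 * π * (-C.amp I₀ * C.intM ρfil n)) = 0 ∧
      C.outerMode n (C.Z₂ * I₀ * besselJ n (C.k₂ * ρfil)) (2 * π * (C.amp I₀ * C.intJ ρfil n))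
        (2 * π * (-C.amp I₀ * C.intM ρfil n)) = 0 := by
  have hΔ := neg_ne_zero.2 (C.denom_ne_zero n)
  have ha := C.two_pi_mul_amp I₀
  set A := C.amp I₀
  have eJ : C.intJ ρfil n * -C.denom n
      = C.Z₂ * besselJ n (C.k₂ * ρfil) * hankel2' n (C.k₁ * C.ρcyl) := div_mul_cancel₀ _ hΔ
  have eM : C.intM ρfil n * -C.denom n = Complex.I * C.Z₁ * C.Z₂ * besselJ n (C.k₂ * ρfil)
      * hankel2 n (C.k₁ * C.ρcyl) := div_mul_cancel₀ _ hΔ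
  have eD : C.denom n = C.Z₁ * hankel2 n (C.k₁ * C.ρcyl) * besselJ' n (C.k₂ * C.ρcyl)
    - C.Z₂ * hankel2' n (C.k₁ * C.ρcyl) * besselJ n (C.k₂ * C.ρcyl) := rfl
  constructor
  · refine (mul_eq_zero_iff_left hΔ).1 ?_
    rw [innerMode]
    linear_combination (2 * π * A * C.ρcyl * C.Z₁ * hankel2 n (C.k₁ * C.ρcyl)) * eJ
      + (2 * π * A * C.ρcyl * Complex.I * hankel2' n (C.k₁ * C.ρcyl)) * eM
      + (2 * π * A * C.ρcyl * hankel2' n (C.k₁ * C.ρcyl) * C.Z₁ * C.Z₂ * besselJ n (C.k₂ * ρfil)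
        * hankel2 n (C.k₁ * C.ρcyl)) * Complex.I_mul_I
  · refine (mul_eq_zero_iff_left hΔ).1 ?_
    rw [outerMode, ← ha]
    linear_combination (-(2 * π * A * C.ρcyl) * C.Z₂ * besselJ n (C.k₂ * C.ρcyl)) * eJ
      - (2 * π * A * C.ρcyl * Complex.I * besselJ' n (C.k₂ * C.ρcyl)) * eM
      - (2 * π * A * C.ρcyl * C.Z₂ * besselJ n (C.k₂ * ρfil)) * eD
      - (2 * π * A * C.ρcyl * besselJ' n (C.k₂ * C.ρcyl) * C.Z₁ * C.Z₂ * besselJ n (C.k₂ * ρfil)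
        * hankel2 n (C.k₁ * C.ρcyl)) * Complex.I_mul_I

theorem ae_eq_of_fourierInt_eq {f g : ℝ → ℂ} (hf : IntervalIntegrable f volume (-π) π)
    (hg : IntervalIntegrable g volume (-π) π) (h : ∀ n, fourierInt f n = fourierInt g n) :
    ∀ᵐ φ ∂(volume.restrict (Set.Ioc (-π) π)), f φ = g φ := by
  have hg' : IntervalIntegrable (fun x => -g x) volume (-π) π := hg.neg
  have h1 := ae_eq_zero_of_fourierInt_eq_zero (f := fun x => f x + -g x) (hf.add hg') fun n => by
    rw [fourierInt_add hf hg', fourierInt_neg, h, add_neg_cancel]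
  filter_upwards [h1] with φ hφ
  exact add_neg_eq_zero.1 hφ

/-- Series whose coefficients solve the modal equations solve the system, and every other solution
has the same coefficients in all modes that the first equation can see. -/
theorem SolvesModes.series_and_unique {ρ₁ : ℝ} {s t a b : ℤ → ℂ} {α β : ℂ}
    (ha : Summable fun n => ‖a n‖)
    (hb : Summable fun n => ‖b n‖)
    (h : ∀ n, C.innerMode n (s n) (2 * π * (α * a n)) (2 * π * (β * b n)) = 0 ∧
      C.outerMode n (t n) (2 * π * (α * a n)) (2 * π * (β * b n)) = 0) :
    C.SolvesModes ρ₁ s t (fun φ => α * fourierSum a φ) (fun φ => β * fourierSum b φ) ∧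
      ∀ J M : ℝ → ℂ, C.SolvesModes ρ₁ s t J M →
        (∀ n : ℤ, besselJ n (C.k₁ * ρ₁) ≠ 0 →
          fourierCoeffOn (neg_lt_self Real.pi_pos) J n = α * a n ∧
          fourierCoeffOn (neg_lt_self Real.pi_pos) M n = β * b n) ∧
        ((∀ n : ℤ, besselJ n (C.k₁ * ρ₁) ≠ 0) →
          (∀ᵐ φ ∂(volume.restrict (Set.Ioc (-π) π)), J φ = α * fourierSum a φ) ∧
          (∀ᵐ φ ∂(volume.restrict (Set.Ioc (-π) π)), M φ = β * fourierSum b φ)) := by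
  have hpi : (2 * π : ℂ) ≠ 0 := mul_ne_zero two_ne_zero (by exact_mod_cast Real.pi_ne_zero)
  have fa : ∀ n, fourierInt (fun φ => α * fourierSum a φ) n = 2 * π * (α * a n) := fun n => by
    rw [fourierInt_const_mul, fourierInt_fourierSum ha]; ring
  have fb : ∀ n, fourierInt (fun φ => β * fourierSum b φ) n = 2 * π * (β * b n) := fun n => by
    rw [fourierInt_const_mul, fourierInt_fourierSum hb]; ring
  have ia : IntervalIntegrable (fun φ => α * fourierSum a φ) volume (-π) π :=
    (continuous_const.mul (continuous_fourierSum ha)).intervalIntegrable _ _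
  have ib : IntervalIntegrable (fun φ => β * fourierSum b φ) volume (-π) π :=
    (continuous_const.mul (continuous_fourierSum hb)).intervalIntegrable _ _
  refine ⟨⟨ia, ib, fun n => ?_, fun n => ?_⟩, fun J M ⟨iJ, iM, e1, e2⟩ => ?_⟩
  · rw [fa, fb, (h n).1, mul_zero]
  · rw [fa, fb, (h n).2]
  have hcoef : ∀ n : ℤ, besselJ n (C.k₁ * ρ₁) ≠ 0 →
      fourierInt J n = 2 * π * (α * a n) ∧ fourierInt M n = 2 * π * (β * b n) := fun n hn =>
    modes_unique ((mul_eq_zero_iff_left (by exact_mod_cast hn)).1 (e1 n)) (e2 n) (h n).1 (h n).2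
  refine ⟨fun n hn => ?_, fun hn => ⟨?_, ?_⟩⟩
  · rw [fourierCoeffOn_eq_fourierInt, fourierCoeffOn_eq_fourierInt, (hcoef n hn).1, (hcoef n hn).2,
      mul_div_cancel_left₀ _ hpi, mul_div_cancel_left₀ _ hpi]
    exact ⟨rfl, rfl⟩
  · exact ae_eq_of_fourierInt_eq iJ ia fun n => (hcoef n (hn n)).1.trans (fa n).symm
  · exact ae_eq_of_fourierInt_eq iM ib fun n => (hcoef n (hn n)).2.trans (fb n).symm

end Cylinder

end NullField

theorem mainTheorem2 (C : NullField.Cylinder) (I₀ : ℂ) :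
    -- the common denominator of all coefficients never vanishes
    (∀ n : ℤ, C.denom n ≠ 0) ∧
    -- external excitation
    (∀ ρfil : ℝ, C.ρcyl < ρfil →
      (fun n : ℤ => C.extJ ρfil n) ~[cofinite]
        (fun n : ℤ => ((C.Z₁ / (C.Z₁ + C.Z₂ * C.k₂ / C.k₁)
          * (C.ρcyl / ρfil) ^ n.natAbs : ℝ) : ℂ)) ∧
      (fun n : ℤ => C.extM ρfil n) ~[cofinite]
        (fun n : ℤ => Complex.I * ((C.Z₁ * C.Z₂ / (C.Z₁ / C.k₂ + C.Z₂ / C.k₁)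
          * (C.ρcyl / n.natAbs) * (C.ρcyl / ρfil) ^ n.natAbs : ℝ) : ℂ)) ∧
      Summable (fun n : ℤ => ‖C.extJ ρfil n‖) ∧
      Summable (fun n : ℤ => ‖C.extM ρfil n‖) ∧
      ∀ ρaux₁ ρaux₂ : ℝ, 0 < ρaux₁ → ρaux₁ < C.ρcyl → C.ρcyl < ρaux₂ →
        C.SolvesExternal I₀ ρfil ρaux₁ ρaux₂
          (fun φ => -C.amp I₀ * fourierSum (C.extJ ρfil) φ)
          (fun φ => C.amp I₀ * fourierSum (C.extM ρfil) φ) ∧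
        ∀ J M : ℝ → ℂ, C.SolvesExternal I₀ ρfil ρaux₁ ρaux₂ J M →
          (∀ n : ℤ, besselJ n (C.k₁ * ρaux₁) ≠ 0 →
            fourierCoeffOn (neg_lt_self Real.pi_pos) J n = -C.amp I₀ * C.extJ ρfil n ∧
            fourierCoeffOn (neg_lt_self Real.pi_pos) M n = C.amp I₀ * C.extM ρfil n) ∧
          ((∀ n : ℤ, besselJ n (C.k₁ * ρaux₁) ≠ 0) →
            (∀ᵐ φ ∂(volume.restrict (Set.Ioc (-π) π)),
              J φ = -C.amp I₀ * fourierSum (C.extJ ρfil) φ) ∧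
            (∀ᵐ φ ∂(volume.restrict (Set.Ioc (-π) π)),
              M φ = C.amp I₀ * fourierSum (C.extM ρfil) φ))) ∧
    -- internal excitation
    (∀ ρfil : ℝ, 0 ≤ ρfil → ρfil < C.ρcyl →
      (fun n : ℤ => C.intJ ρfil n) ~[cofinite]
        (fun n : ℤ => ((C.Z₂ / (C.Z₂ + C.Z₁ * C.k₁ / C.k₂)
          * (ρfil / C.ρcyl) ^ n.natAbs : ℝ) : ℂ)) ∧
      (fun n : ℤ => C.intM ρfil n) ~[cofinite]
        (fun n : ℤ => -Complex.I * ((C.Z₁ * C.Z₂ / (C.Z₁ / C.k₂ + C.Z₂ / C.k₁)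
          * (C.ρcyl / n.natAbs) * (ρfil / C.ρcyl) ^ n.natAbs : ℝ) : ℂ)) ∧
      Summable (fun n : ℤ => ‖C.intJ ρfil n‖) ∧
      Summable (fun n : ℤ => ‖C.intM ρfil n‖) ∧
      ∀ ρaux₁ ρaux₂ : ℝ, 0 < ρaux₁ → ρaux₁ < C.ρcyl → C.ρcyl < ρaux₂ →
        C.SolvesInternal I₀ ρfil ρaux₁ ρaux₂
          (fun φ => C.amp I₀ * fourierSum (C.intJ ρfil) φ)
          (fun φ => -C.amp I₀ * fourierSum (C.intM ρfil) φ) ∧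
        ∀ J M : ℝ → ℂ, C.SolvesInternal I₀ ρfil ρaux₁ ρaux₂ J M →
          (∀ n : ℤ, besselJ n (C.k₁ * ρaux₁) ≠ 0 →
            fourierCoeffOn (neg_lt_self Real.pi_pos) J n = C.amp I₀ * C.intJ ρfil n ∧
            fourierCoeffOn (neg_lt_self Real.pi_pos) M n = -C.amp I₀ * C.intM ρfil n) ∧
          ((∀ n : ℤ, besselJ n (C.k₁ * ρaux₁) ≠ 0) →
            (∀ᵐ φ ∂(volume.restrict (Set.Ioc (-π) π)),
              J φ = C.amp I₀ * fourierSum (C.intJ ρfil) φ) ∧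
            (∀ᵐ φ ∂(volume.restrict (Set.Ioc (-π) π)),
              M φ = -C.amp I₀ * fourierSum (C.intM ρfil) φ))) := by
  refine ⟨C.denom_ne_zero, fun ρfil hfil => ?_, fun ρfil hfil0 hfil => ?_⟩
  · refine ⟨Cylinder.extJ_isEquivalent hfil, Cylinder.extM_isEquivalent hfil,
      Cylinder.summable_extJ hfil, Cylinder.summable_extM hfil, fun ρ₁ ρ₂ h0 h1 h2 => ?_⟩
    simp only [Cylinder.solvesExternal_iff hfil h0 h1 h2]
    exact Cylinder.SolvesModes.series_and_unique (Cylinder.summable_extJ hfil)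
      (Cylinder.summable_extM hfil)
      (Cylinder.external_modes I₀ ρfil)
  · refine ⟨Cylinder.intJ_isEquivalent hfil0, Cylinder.intM_isEquivalent hfil0,
      Cylinder.summable_intJ hfil0 hfil, Cylinder.summable_intM hfil0 hfil,
      fun ρ₁ ρ₂ h0 h1 h2 => ?_⟩
    simp only [Cylinder.solvesInternal_iff hfil0 hfil h0 h1 h2]
    exact Cylinder.SolvesModes.series_and_unique (Cylinder.summable_intJ hfil0 hfil)
      (Cylinder.summable_intM hfil0 hfil) (Cylinder.internal_modes I₀ ρfil)
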